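/- Let the square grid be the infinite graph on $\mathbb{Z}^2$ in which two points are adjacent if and only if they are at Euclidean distance $1$. A *square grid graph* is a graph isomorphic to the subgraph of the grid induced by a finite set $S\subset\mathbb{Z}^2$ such that every vertex in $S$, and every grid edge with both ends in $S$, belongs to a unit square all of whose four corners lie in $S$. A graph $G=(V,E)$ is *$12$-representable* if its vertices can be labelled by distinct positive integers so that there is a finite word $w$, whose set of letters is exactly the set of labels, with the following property: for all distinct vertices $x,y$, we have $xy\notin E$ if and only if the word $w_{\{x,y\}}$, obtained from $w$ by deleting all letters other than the labels of $x$ and $y$, contains the (consecutive) pattern $12$, i.e. contains two consecutive letters of which the first is smaller than the second. Let $X$ be the graph with vertices $a,b,c,d,e,f,g,h,i$ and edges $ab,\ bc,\ cd,\ de,\ ef,\ fc,\ bg,\ gh,\ hi,\ if,\ fg$ (three unit squares in an L-shape with a pendant edge at the outer corner $b$ of the middle square $bcfg$), let $C_{m}$ be the cycle on $m$ vertices, and let $F=\{X\}\cup\{C_{2n}: n\ge 4\}$. A graph is *$F$-avoiding* if it has no induced subgraph isomorphic to a member of $F$. **Theorem.** A square grid graph is $12$-representable if and only if it is $F$-avoiding.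 -/

import Mathlib

open scoped SimpleGraph

/-- The reduced form of a word: every occurrence of the `i`-th smallest letter that occurs in the
word is replaced by `i`. -/
def redWord (w : List ℕ) : List ℕ :=
  w.map fun a => (w.toFinset.filter (· ≤ a)).card

/-- `w` contains an occurrence of the consecutive pattern `u`: some factor (block of consecutive
letters) of `w` has reduced form `u`. -/
def ContainsPattern (u w : List ℕ) : Prop :=
  ∃ v : List ℕ, v <:+: w ∧ redWord v = u

/-- The word obtained from `w` by removing all letters other than `x` and `y`. -/
def restrictWord (w : List ℕ) (x y : ℕ) : List ℕ :=
  w.filter fun a => a = x ∨ a = y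

/-- With the vertices of `G` labelled by `ℓ`, the word `w` `u`-represents `G`: the letters of `w`
are exactly the labels, and two distinct vertices are non-adjacent iff the restriction of `w` to
their labels contains the pattern `u`. -/
def Represents {V : Type*} (u w : List ℕ) (G : SimpleGraph V) (ℓ : V → ℕ) : Prop :=
  (∀ a : ℕ, a ∈ w ↔ ∃ v : V, ℓ v = a) ∧
    ∀ x y : V, x ≠ y → (¬ G.Adj x y ↔ ContainsPattern u (restrictWord w (ℓ x) (ℓ y)))

/-- An (unlabelled) graph is `u`-representable if some labelling of its vertices by distinct
positive integers admits a word that `u`-represents it. -/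
def IsRepresentable {V : Type*} (u : List ℕ) (G : SimpleGraph V) : Prop :=
  ∃ ℓ : V → ℕ, Function.Injective ℓ ∧ (∀ v, 0 < ℓ v) ∧ ∃ w : List ℕ, Represents u w G ℓ

/-- 12-representable graphs. -/
def Is12Representable {V : Type*} (G : SimpleGraph V) : Prop :=
  IsRepresentable [1, 2] G

/-- The infinite square grid: integer points, adjacent when at Euclidean distance 1. -/
def squareGrid : SimpleGraph (ℤ × ℤ) where
  Adj p q := |p.1 - q.1| + |p.2 - q.2| = 1
  symm := ⟨fun p q h => by simpa only [abs_sub_comm] using h⟩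
  loopless := ⟨fun p h => by simp at h⟩

/-- The four corners of the unit square with lower left corner `c`. -/
def unitSquare (c : ℤ × ℤ) : Finset (ℤ × ℤ) :=
  {(c.1, c.2), (c.1 + 1, c.2), (c.1, c.2 + 1), (c.1 + 1, c.2 + 1)}

/-- The subgraph of the grid induced by `S` is made up of squares: every vertex in `S`, and every
grid edge with both ends in `S`, belongs to a unit square all of whose corners are in `S`. -/
def MadeOfSquares (S : Finset (ℤ × ℤ)) : Prop :=
  (∀ p ∈ S, ∃ c, unitSquare c ⊆ S ∧ p ∈ unitSquare c) ∧
    ∀ p ∈ S, ∀ q ∈ S, squareGrid.Adj p q →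
      ∃ c, unitSquare c ⊆ S ∧ p ∈ unitSquare c ∧ q ∈ unitSquare c

/-- A square grid graph: a graph isomorphic to a finite induced subgraph of the grid that is made
up of squares. -/
def IsSquareGridGraph {V : Type*} (G : SimpleGraph V) : Prop :=
  ∃ S : Finset (ℤ × ℤ), MadeOfSquares S ∧
    Nonempty (G ≃g squareGrid.induce (S : Set (ℤ × ℤ)))

/-- The graph `X`: three unit squares in an L-shape, with a pendant vertex attached to the outer
corner of the middle square. The vertices `0, …, 8` stand for `a, …, i`, drawn at the grid points
`(-1,0), (0,0), (0,1), (0,2), (1,2), (1,1), (1,0), (2,0), (2,1)`; the middle square is `bcfg`, the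
other two squares are `cdef` and `fghi`, and the pendant edge is `ab`. -/
def graphX : SimpleGraph (Fin 9) :=
  SimpleGraph.fromEdgeSet
    {s(0, 1), s(1, 2), s(2, 3), s(3, 4), s(4, 5), s(5, 2), s(1, 6), s(6, 7), s(7, 8), s(8, 5),
      s(5, 6)}

/-- `G` is `F`-avoiding for `F = {X} ∪ {C_{2n} : n ≥ 4}`: it has no induced subgraph isomorphic
to a member of `F`. -/
def IsFAvoiding {V : Type*} (G : SimpleGraph V) : Prop :=
  ¬ graphX ⊴ G ∧ ∀ n : ℕ, 4 ≤ n → ¬ SimpleGraph.cycleGraph (2 * n) ⊴ G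

/-! For labels `a < b`, the restricted word contains 12 exactly when some `a` precedes some `b`, so
only first and last occurrences matter: for finite graphs, 12-representability is the existence of
an interval model, a property inherited by induced subgraphs.

Necessity. In an interval model two independent edges span disjoint label intervals
(`HasIntervalModel.exists_labelling`). Hence an edge that slides along a path of edges, all
independent of a fixed edge, stays on one side of it. In `graphX` this prevents each of three
pairwise independent edges from lying between the other two; around a long cycle it makes the labels
increase or decrease forever.

Sufficiency. The unit squares in `S` form `linkGraph S`. A cycle of links would enclose a hole and
yield an induced even cycle of length at least 8 (`linkGraph_isAcyclic`); a square with three links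
would yield a copy of `graphX` (`linkGraph_degree_le_two`). So the squares form disjoint paths and
can be laid out on a line with linked squares consecutive. The squares containing a given point are
then consecutive, which assigns an interval to each point, and two intervals meet exactly when the
points share a square (`exists_interval_of_layout`). Points of opposite parity in a common square
are adjacent, so the graph is a bipartite intersection graph of intervals, and such a graph has an
interval model (`hasIntervalModel_of_bipartite_intervals`). -/

/-- `G` has an *interval model*: an injective labelling `ℓ` and intervals `[f v, l v]` such that
vertices `x`, `y` with `ℓ x < ℓ y` are adjacent iff the interval of `y` lies entirely before the
interval of `x`. -/
def HasIntervalModel {V : Type*} (G : SimpleGraph V) : Prop :=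
  ∃ ℓ f l : V → ℕ, Function.Injective ℓ ∧ (∀ v, f v ≤ l v) ∧
    ∀ x y, ℓ x < ℓ y → (G.Adj x y ↔ l y < f x)

/-! ### Words containing 12 and interval models -/

theorem redWord_pair {a b : ℕ} (h : a < b) : redWord [a, b] = [1, 2] := by
  have h1 : ({a, b} : Finset ℕ).filter (· ≤ a) = {a} := by
    ext z; simp; omega
  have h2 : ({a, b} : Finset ℕ).filter (· ≤ b) = {a, b} := by
    ext z; simp; omega
  simp [redWord, h1, h2, Finset.card_pair h.ne]

theorem exists_pair_of_redWord {v : List ℕ} (h : redWord v = [1, 2]) :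
    ∃ a b, a < b ∧ v = [a, b] := by
  have hl : v.length = 2 := by simpa [redWord] using congrArg List.length h
  obtain ⟨a, b, rfl⟩ := List.length_eq_two.1 hl
  refine ⟨a, b, ?_, rfl⟩
  by_contra hab
  have h1 : b ∈ ({a, b} : Finset ℕ).filter (· ≤ a) := by simp; omega
  simp only [redWord, List.map_cons, List.map_nil, List.toFinset_cons, List.toFinset_nil,
    List.cons.injEq, and_true, insert_empty_eq] at h
  obtain ⟨h2, h3⟩ := h
  obtain ⟨c, hc⟩ := Finset.card_eq_one.1 h2
  have h4 : a ∈ ({a, b} : Finset ℕ).filter (· ≤ a) := by simp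
  rw [hc, Finset.mem_singleton] at h1 h4
  subst h1; subst h4
  have := Finset.card_le_card (Finset.filter_subset (· ≤ a) ({a, a} : Finset ℕ))
  simp at this h3
  omega

/-- In a two-letter word, the last `a` before an occurrence of `b` is followed directly by `b`. -/
theorem pair_infix_of_sublist {a b : ℕ} {w : List ℕ} (hw : ∀ z ∈ w, z = a ∨ z = b)
    (hab : a ≠ b) (h : [a, b].Sublist w) : [a, b] <:+: w := by
  induction w with
  | nil => simp at h
  | cons c w ih =>
    have hw' : ∀ z ∈ w, z = a ∨ z = b := fun z hz => hw z (List.mem_cons_of_mem _ hz)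
    by_cases h' : [a, b].Sublist w
    · exact (ih hw' h').trans (List.suffix_cons c w).isInfix
    · cases h with
      | cons _ h => exact absurd h h'
      | cons_cons _ h =>
        cases w with
        | nil => simp at h
        | cons d w =>
          rcases hw' d List.mem_cons_self with rfl | rfl
          · exact absurd (by simpa using (by simpa using h : b = d ∨ b ∈ w).resolve_left hab.symm) h'
          · exact ⟨[], w, by simp⟩

theorem containsPattern_restrictWord {a b : ℕ} (h : a < b) (w : List ℕ) :
    ContainsPattern [1, 2] (restrictWord w a b) ↔ [a, b].Sublist w := by
  have hmem : ∀ z ∈ restrictWord w a b, z = a ∨ z = b := by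
    intro z hz
    simpa using (List.mem_filter.1 hz).2
  constructor
  · rintro ⟨v, hv, hr⟩
    obtain ⟨c, d, hcd, rfl⟩ := exists_pair_of_redWord hr
    have hc := hmem c (hv.subset (by simp))
    have hd := hmem d (hv.subset (by simp))
    obtain rfl : c = a := by omega
    obtain rfl : d = b := by omega
    exact hv.sublist.trans List.filter_sublist
  · intro hs
    refine ⟨[a, b], pair_infix_of_sublist hmem h.ne ?_, redWord_pair h⟩
    simpa [restrictWord] using hs.filter (fun z => decide (z = a ∨ z = b))

theorem restrictWord_comm (w : List ℕ) (a b : ℕ) : restrictWord w a b = restrictWord w b a := by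
  simp only [restrictWord, or_comm]

theorem pair_sublist_iff_getElem {a b : ℕ} {w : List ℕ} :
    [a, b].Sublist w ↔ ∃ i j : ℕ, i < j ∧ w[i]? = some a ∧ w[j]? = some b := by
  rw [List.sublist_iff_exists_orderEmbedding_getElem?_eq]
  constructor
  · rintro ⟨f, hf⟩
    exact ⟨f 0, f 1, f.strictMono Nat.zero_lt_one, by simpa using (hf 0).symm,
      by simpa using (hf 1).symm⟩
  · rintro ⟨i, j, hij, hi, hj⟩
    have hjl : j < w.length := (List.getElem?_eq_some_iff.1 hj).1
    -- The embedding is defined on all of ℕ; indices from 2 on go past the end of `w`, where both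
    -- lookups give `none`.
    refine ⟨OrderEmbedding.ofStrictMono
      (fun n => if n = 0 then i else if n = 1 then j else n + w.length + j) ?_, ?_⟩
    · intro m n hmn
      dsimp only
      split_ifs <;> omega
    · rintro (_ | _ | n)
      · exact hi.symm
      · exact hj.symm
      · change none = w[n + 2 + w.length + j]?
        simp; omega

theorem Is12Representable.hasIntervalModel {V : Type*} {G : SimpleGraph V}
    (h : Is12Representable G) : HasIntervalModel G := by
  classical
  obtain ⟨ℓ, hinj, -, w, hw, hrep⟩ := h
  have hex : ∀ v, ∃ i, w[i]? = some (ℓ v) := fun v => List.mem_iff_getElem?.1 ((hw _).2 ⟨v, rfl⟩)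
  let P : V → ℕ → Prop := fun v i => w[i]? = some (ℓ v)
  have hle : ∀ v i, P v i → i ≤ w.length := fun v i hi =>
    (List.getElem?_eq_some_iff.1 hi).1.le
  have hf : ∀ v, P v (Nat.find (hex v)) := fun v => Nat.find_spec (hex v)
  have hl : ∀ v, P v (Nat.findGreatest (P v) w.length) := fun v =>
    Nat.findGreatest_spec (hle v _ (hf v)) (hf v)
  refine ⟨ℓ, fun v => Nat.find (hex v), fun v => Nat.findGreatest (P v) w.length, hinj,
    fun v => Nat.find_min' _ (hl v), fun x y hxy => ?_⟩
  have hne : x ≠ y := fun h => by simp [h] at hxy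
  have := (hrep x y hne).trans (containsPattern_restrictWord hxy w)
  rw [← not_iff_not, this, pair_sublist_iff_getElem, not_lt]
  constructor
  · rintro ⟨i, j, hij, hi, hj⟩
    exact (Nat.find_min' (hex x) hi).trans
      (hij.le.trans (Nat.le_findGreatest (P := P y) (hle y j hj) hj))
  · intro h
    refine ⟨_, _, lt_of_le_of_ne h fun he => ?_, hf x, hl y⟩
    have h1 := hf x
    have h2 := hl y
    dsimp only at he
    rw [← he] at h2
    exact hne (hinj (Option.some.inj (h1.symm.trans h2)))

theorem HasIntervalModel.comap {V W : Type*} {G : SimpleGraph V} {H : SimpleGraph W}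
    (h : HasIntervalModel G) (e : H ↪g G) : HasIntervalModel H := by
  obtain ⟨ℓ, f, l, hinj, hfl, had⟩ := h
  exact ⟨ℓ ∘ e, f ∘ e, l ∘ e, hinj.comp e.injective, fun v => hfl _, fun x y hxy => by
    rw [← e.map_adj_iff]; exact had _ _ hxy⟩

theorem pair_sublist_sort_map {α : Type*} [LinearOrder α] (E : Finset α) (g : α → ℕ) {a b : ℕ} :
    [a, b].Sublist ((E.sort (· ≤ ·)).map g) ↔ ∃ x ∈ E, ∃ y ∈ E, x < y ∧ g x = a ∧ g y = b := by
  rw [List.sublist_map_iff]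
  have hp : (E.sort (· ≤ ·)).Pairwise (· < ·) := E.sortedLT_sort.pairwise
  constructor
  · rintro ⟨l, hl, he⟩
    obtain ⟨x, y, rfl⟩ : ∃ x y, l = [x, y] :=
      List.length_eq_two.1 (by simpa using (congrArg List.length he).symm)
    simp only [List.map_cons, List.map_nil, List.cons.injEq, and_true] at he
    have hlt : x < y := by simpa using hp.sublist hl
    exact ⟨x, by simpa using hl.subset (List.mem_cons_self), y,
      by simpa using hl.subset (List.mem_cons_of_mem _ List.mem_cons_self), hlt,
      he.1.symm, he.2.symm⟩
  · rintro ⟨x, hx, y, hy, hxy, rfl, rfl⟩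
    refine ⟨[x, y], ?_, by simp⟩
    apply List.sublist_of_subperm_of_pairwise (r := (· < ·)) _ _ hp
    · refine List.subperm_of_subset (by simp [hxy.ne]) ?_
      intro z hz
      simp only [List.mem_cons, List.not_mem_nil, or_false] at hz
      rcases hz with rfl | rfl <;> simpa
    · simpa using hxy

theorem HasIntervalModel.is12Representable {V : Type*} [Finite V] {G : SimpleGraph V}
    (h : HasIntervalModel G) : Is12Representable G := by
  classical
  have := Fintype.ofFinite V
  obtain ⟨ℓ, f, l, hinj, hfl, had⟩ := h
  -- The word lists the interval endpoints in order, ties broken by label. If `f x = l y` with `ℓ x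
  -- < ℓ y`, then `x` comes first, as non-adjacency demands. The shift by 1 makes the letters
  -- positive.
  let E : Finset (ℕ ×ₗ ℕ) := Finset.univ.image (fun v => toLex (f v, ℓ v + 1)) ∪
    Finset.univ.image (fun v => toLex (l v, ℓ v + 1))
  let g : ℕ ×ₗ ℕ → ℕ := fun z => (ofLex z).2
  have hE : ∀ z, z ∈ E ↔ ∃ v, z = toLex (f v, ℓ v + 1) ∨ z = toLex (l v, ℓ v + 1) := by
    intro z
    simp only [E, Finset.mem_union, Finset.mem_image, Finset.mem_univ, true_and]
    constructor
    · rintro (⟨v, rfl⟩ | ⟨v, rfl⟩)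
      exacts [⟨v, Or.inl rfl⟩, ⟨v, Or.inr rfl⟩]
    · rintro ⟨v, rfl | rfl⟩
      exacts [Or.inl ⟨v, rfl⟩, Or.inr ⟨v, rfl⟩]
  have key : ∀ x y, ℓ x < ℓ y →
      (¬ G.Adj x y ↔ [ℓ x + 1, ℓ y + 1].Sublist ((E.sort (· ≤ ·)).map g)) := by
    intro x y hxy
    rw [had x y hxy, pair_sublist_sort_map, not_lt]
    constructor
    · intro h
      refine ⟨_, (hE _).2 ⟨x, Or.inl rfl⟩, _, (hE _).2 ⟨y, Or.inr rfl⟩, ?_, rfl, rfl⟩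
      rw [Prod.Lex.toLex_lt_toLex]
      simp only
      omega
    · rintro ⟨z, hz, z', hz', hlt, h1, h2⟩
      obtain ⟨v, hv⟩ := (hE z).1 hz
      obtain ⟨v', hv'⟩ := (hE z').1 hz'
      have e1 : v = x := hinj (by rcases hv with rfl | rfl <;> simpa [g] using h1)
      have e2 : v' = y := hinj (by rcases hv' with rfl | rfl <;> simpa [g] using h2)
      subst e1 e2
      have h3 := hfl v
      have h4 := hfl v'
      rcases hv with rfl | rfl <;> rcases hv' with rfl | rfl <;>
        rw [Prod.Lex.toLex_lt_toLex] at hlt <;> simp only at hlt <;> omega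
  refine ⟨fun v => ℓ v + 1, fun a b hab => hinj (by simpa using hab), fun v => by simp,
    (E.sort (· ≤ ·)).map g, fun a => ?_, fun x y hxy => ?_⟩
  · simp only [List.mem_map, Finset.mem_sort]
    constructor
    · rintro ⟨z, hz, rfl⟩
      obtain ⟨v, rfl | rfl⟩ := (hE z).1 hz <;> exact ⟨v, rfl⟩
    · rintro ⟨v, rfl⟩
      exact ⟨_, (hE _).2 ⟨v, Or.inl rfl⟩, rfl⟩
  · rcases lt_or_gt_of_ne (fun h => hxy (hinj h) : ℓ x ≠ ℓ y) with h | h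
    · rw [key x y h, containsPattern_restrictWord (by simpa using h)]
    · rw [restrictWord_comm, G.adj_comm, key y x h, containsPattern_restrictWord (by simpa using h)]

/-! ### Forbidden subgraphs have no interval model -/

/-- Labels of a graph with an interval model: the label intervals spanned by two edges that have
no vertex in common and are not joined by an edge are disjoint. -/
theorem HasIntervalModel.exists_labelling {V : Type*} {G : SimpleGraph V}
    (h : HasIntervalModel G) : ∃ ℓ : V → ℕ, ∀ u v u' v', G.Adj u v → G.Adj u' v' →
      u ≠ u' → u ≠ v' → v ≠ u' → v ≠ v' →
      ¬ G.Adj u u' → ¬ G.Adj u v' → ¬ G.Adj v u' → ¬ G.Adj v v' →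
      max (ℓ u) (ℓ v) < min (ℓ u') (ℓ v') ∨ max (ℓ u') (ℓ v') < min (ℓ u) (ℓ v) := by
  obtain ⟨ℓ, f, l, hinj, hfl, had⟩ := h
  refine ⟨ℓ, ?_⟩
  have main : ∀ x y x' y', G.Adj x y → G.Adj x' y' → ℓ x < ℓ y → ℓ x' < ℓ y' →
      x ≠ y' → x' ≠ y → ¬ G.Adj x y' → ¬ G.Adj x' y → ℓ y < ℓ x' ∨ ℓ y' < ℓ x := by
    intro x y x' y' h1 h2 h3 h4 h5 h6 h7 h8
    -- Otherwise all four pairs are ordered by label, and `l y < f x ≤ l y' < f x' ≤ l y`.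
    by_contra! hcon
    have e1 : ℓ x < ℓ y' := lt_of_le_of_ne hcon.2 fun h => h5 (hinj h)
    have e2 : ℓ x' < ℓ y := lt_of_le_of_ne hcon.1 fun h => h6 (hinj h)
    rw [had _ _ h3] at h1
    rw [had _ _ h4] at h2
    rw [had _ _ e1] at h7
    rw [had _ _ e2] at h8
    omega
  intro u v u' v' h1 h2 a1 a2 a3 a4 b1 b2 b3 b4
  have n1 : ℓ u ≠ ℓ v := fun h => h1.ne (hinj h)
  have n2 : ℓ u' ≠ ℓ v' := fun h => h2.ne (hinj h)
  have c1 := fun h => b1 (SimpleGraph.Adj.symm h)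
  have c2 := fun h => b2 (SimpleGraph.Adj.symm h)
  have c3 := fun h => b3 (SimpleGraph.Adj.symm h)
  have c4 := fun h => b4 (SimpleGraph.Adj.symm h)
  rcases lt_or_gt_of_ne n1 with h | h <;> rcases lt_or_gt_of_ne n2 with h' | h'
  · have := main u v u' v' h1 h2 h h' a2 a3.symm b2 c3; omega
  · have := main u v v' u' h1 h2.symm h h' a1 a4.symm b1 c4; omega
  · have := main v u u' v' h1.symm h2 h h' a4 a1.symm b4 c1; omega
  · have := main v u v' u' h1.symm h2.symm h h' a3 a2.symm b3 c2; omega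

/-- The edges 01, 34 and 78 are pairwise independent, so one of their label intervals lies between
the other two. But any two of them are joined by a path of edges independent of the third, hence lie
on the same side of it. -/
theorem graphX_not_hasIntervalModel : ¬ HasIntervalModel graphX := by
  intro h
  obtain ⟨ℓ, hℓ⟩ := h.exists_labelling
  have key : ∀ u v u' v' : Fin 9, (graphX.Adj u v ∧ graphX.Adj u' v' ∧
      u ≠ u' ∧ u ≠ v' ∧ v ≠ u' ∧ v ≠ v' ∧
      ¬ graphX.Adj u u' ∧ ¬ graphX.Adj u v' ∧ ¬ graphX.Adj v u' ∧ ¬ graphX.Adj v v') →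
      max (ℓ u) (ℓ v) < min (ℓ u') (ℓ v') ∨ max (ℓ u') (ℓ v') < min (ℓ u) (ℓ v) := by
    rintro u v u' v' ⟨h1, h2, h3, h4, h5, h6, h7, h8, h9, h10⟩
    exact hℓ u v u' v' h1 h2 h3 h4 h5 h6 h7 h8 h9 h10
  -- Two edges sharing the vertex `b` cannot lie on opposite sides of `de`.
  have shift : ∀ a b c d e : ℕ, (max a b < min d e ∨ max d e < min a b) →
      (max b c < min d e ∨ max d e < min b c) →
      (max a b < min d e ↔ max b c < min d e) := by
    intro a b c d e h1 h2
    omega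
  have d1 := key 0 1 7 8 (by simp [graphX])
  have d2 := key 1 2 7 8 (by simp [graphX])
  have d3 := key 2 3 7 8 (by simp [graphX])
  have d4 := key 3 4 7 8 (by simp [graphX])
  have d5 := key 0 1 3 4 (by simp [graphX])
  have d6 := key 1 6 3 4 (by simp [graphX])
  have d7 := key 6 7 3 4 (by simp [graphX])
  have d8 := key 4 5 0 1 (by simp [graphX])
  have d9 := key 5 8 0 1 (by simp [graphX])
  have d10 := key 3 4 0 1 (by simp [graphX])
  have d11 := key 8 7 0 1 (by simp [graphX])
  have d12 := key 7 8 3 4 (by simp [graphX])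
  have e1 := ((shift _ _ _ _ _ d1 d2).trans (shift _ _ _ _ _ d2 d3)).trans
    (shift _ _ _ _ _ d3 d4)
  have e2 := ((shift _ _ _ _ _ d5 d6).trans (shift _ _ _ _ _ d6 d7)).trans
    (shift _ _ _ _ _ d7 d12)
  have e3 := ((shift _ _ _ _ _ d10 d8).trans (shift _ _ _ _ _ d8 d9)).trans
    (shift _ _ _ _ _ d9 d11)
  clear d2 d3 d6 d7 d8 d9 d12 key hℓ
  omega

theorem cycleGraph_adj_iff_val {n : ℕ} (hn : 2 ≤ n) (u v : Fin (n + 1)) :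
    (SimpleGraph.cycleGraph (n + 1)).Adj u v ↔
      (u.val = v.val + 1 ∨ v.val = u.val + 1 ∨ (u.val = n ∧ v.val = 0) ∨
        (v.val = n ∧ u.val = 0)) := by
  rw [SimpleGraph.cycleGraph_adj']
  have hu := u.isLt
  have hv := v.isLt
  rw [Fin.sub_def, Fin.sub_def]
  simp only
  rcases lt_trichotomy u.val v.val with h | h | h
  · rw [Nat.mod_eq_of_lt (by omega), show n + 1 - u.val + v.val = v.val - u.val + (n + 1) by omega,
      Nat.add_mod_right, Nat.mod_eq_of_lt (by omega)]
    omega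
  · rw [show n + 1 - v.val + u.val = n + 1 by omega, show n + 1 - u.val + v.val = n + 1 by omega,
      Nat.mod_self]
    omega
  · rw [Nat.mod_eq_of_lt (a := n + 1 - u.val + v.val) (by omega),
      show n + 1 - v.val + u.val = u.val - v.val + (n + 1) by omega,
      Nat.add_mod_right, Nat.mod_eq_of_lt (by omega)]
    omega

/-- From length 7 on, the `k`-th edge is independent of edges `k + 3` and `k + 4`. Sliding first one
edge and then the other carries the order of edges `k`, `k + 3` to `k + 1`, `k + 4`, so the label at
position `3 * k` is strictly monotone in `k`, although positions are periodic. -/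
theorem cycleGraph_not_hasIntervalModel {m : ℕ} (hm : 7 ≤ m) :
    ¬ HasIntervalModel (SimpleGraph.cycleGraph m) := by
  intro h
  obtain ⟨ℓ, hℓ⟩ := h.exists_labelling
  obtain ⟨n, rfl⟩ : ∃ n, m = n + 1 := ⟨m - 1, by omega⟩
  have adj_iff := @cycleGraph_adj_iff_val n (by omega)
  let g : ℕ → Fin (n + 1) := fun k => ⟨k % (n + 1), Nat.mod_lt _ (by omega)⟩
  have gs : ∀ k, ((g (k + 1)).val = (g k).val + 1 ∧ (g k).val < n) ∨
      ((g k).val = n ∧ (g (k + 1)).val = 0) := by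
    intro k
    simp only [g]
    have := Nat.mod_lt k (show 0 < n + 1 by omega)
    rcases (show k % (n + 1) < n ∨ k % (n + 1) = n by omega) with h | h
    · left; rw [Nat.add_mod, Nat.mod_eq_of_lt (a := 1) (by omega), Nat.mod_eq_of_lt (by omega)]
      omega
    · right; rw [Nat.add_mod, Nat.mod_eq_of_lt (a := 1) (by omega), h]; simp
  have sep : ∀ k j, j = 3 ∨ j = 4 →
      max (ℓ (g k)) (ℓ (g (k + 1))) < min (ℓ (g (k + j))) (ℓ (g (k + j + 1))) ∨
      max (ℓ (g (k + j))) (ℓ (g (k + j + 1))) < min (ℓ (g k)) (ℓ (g (k + 1))) := by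
    intro k j hj
    have s0 := gs k
    have s1 := gs (k + 1)
    have s2 := gs (k + 2)
    have s3 := gs (k + 3)
    have s4 := gs (k + 4)
    apply hℓ <;> simp only [adj_iff, ne_eq, Fin.ext_iff] <;> rcases hj with rfl | rfl <;>
      simp only [add_assoc, Nat.reduceAdd] at * <;> omega
  let R : ℕ → ℕ → Prop := fun i j => max (ℓ (g i)) (ℓ (g (i + 1))) < min (ℓ (g j)) (ℓ (g (j + 1)))
  have step : ∀ k, R k (k + 3) → R (k + 1) (k + 4) := by
    intro k h
    have h1 := sep k 4 (Or.inr rfl)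
    have h2 := sep (k + 1) 3 (Or.inl rfl)
    simp only [R, add_assoc, Nat.reduceAdd] at *
    omega
  have step' : ∀ k, R (k + 3) k → R (k + 4) (k + 1) := by
    intro k h
    have h1 := sep k 4 (Or.inr rfl)
    have h2 := sep (k + 1) 3 (Or.inl rfl)
    simp only [R, add_assoc, Nat.reduceAdd] at *
    omega
  have hper : g (3 * (n + 1)) = g 0 := by simp [g]
  rcases sep 0 3 (Or.inl rfl) with h0 | h0
  · have hall : ∀ k, R k (k + 3) := by
      intro k
      induction k with
      | zero => exact h0
      | succ k ih => exact step k ih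
    have hmono : StrictMono fun k => ℓ (g (3 * k)) := strictMono_nat_of_lt_succ fun k => by
      have := hall (3 * k)
      simp only [R, mul_add, mul_one, zero_add] at *
      omega
    have := hmono (show 0 < n + 1 by omega)
    simp [hper] at this
  · have hall : ∀ k, R (k + 3) k := by
      intro k
      induction k with
      | zero => exact h0
      | succ k ih => exact step' k ih
    have hmono : StrictAnti fun k => ℓ (g (3 * k)) := strictAnti_nat_of_succ_lt fun k => by
      have := hall (3 * k)
      simp only [R, mul_add, mul_one, zero_add] at *
      omega
    have := hmono (show 0 < n + 1 by omega)
    simp [hper] at this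

/-! ### Induced cycles from shortest paths -/

theorem exists_seq_of_reflTransGen {W : Type*} {r : W → W → Prop} {a b : W}
    (h : Relation.ReflTransGen r a b) :
    ∃ (L : ℕ) (p : ℕ → W), p 0 = a ∧ p L = b ∧ ∀ i < L, r (p i) (p (i + 1)) := by
  induction h with
  | refl => exact ⟨0, fun _ => a, rfl, rfl, by simp⟩
  | @tail b c _ hbc ih =>
    obtain ⟨L, p, h0, hL, hp⟩ := ih
    refine ⟨L + 1, fun i => if i ≤ L then p i else c, by simp [h0], by simp, fun i hi => ?_⟩
    rcases Nat.lt_or_eq_of_le (Nat.lt_succ_iff.1 hi) with h | rfl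
    · simpa [h.le, Nat.succ_le_of_lt h] using hp i h
    · simpa [hL] using hbc

/-- If two sets `P`, `Q` partitioning the neighbourhood of `v` in `T` are joined by a path in `T`
that avoids `v`, but by no path of length at most two, then a shortest such path closes up to an
induced cycle through `v`. -/
theorem exists_induced_cycle {W : Type*} {A : SimpleGraph W} {T : Set W} {v : W} {P Q : Set W}
    (hN : ∀ x ∈ T, A.Adj v x ↔ x ∈ P ∨ x ∈ Q)
    (hne : ∀ p ∈ P, ∀ q ∈ Q, p ≠ q) (hadj : ∀ p ∈ P, ∀ q ∈ Q, ¬ A.Adj p q)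
    (hcom : ∀ p ∈ P, ∀ q ∈ Q, ∀ x ∈ T, x ≠ v → A.Adj p x → ¬ A.Adj x q)
    (hpath : ∃ p ∈ P, ∃ q ∈ Q, Relation.ReflTransGen
      (fun a b => A.Adj a b ∧ (a ∈ T ∧ a ≠ v) ∧ (b ∈ T ∧ b ≠ v)) p q) :
    ∃ L, 3 ≤ L ∧ ∃ p : ℕ → W, (∀ i ≤ L, p i ∈ T ∧ p i ≠ v) ∧
      (∀ i j, i < j → j ≤ L → p i ≠ p j ∧ (A.Adj (p i) (p j) ↔ j = i + 1)) ∧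
      ∀ i ≤ L, A.Adj v (p i) ↔ i = 0 ∨ i = L := by
  classical
  set r : W → W → Prop := fun a b => A.Adj a b ∧ (a ∈ T ∧ a ≠ v) ∧ (b ∈ T ∧ b ≠ v) with hr
  have hex : ∃ L, ∃ p : ℕ → W, p 0 ∈ P ∧ p L ∈ Q ∧ ∀ i < L, r (p i) (p (i + 1)) := by
    obtain ⟨a, ha, b, hb, hab⟩ := hpath
    obtain ⟨L, p, h0, hL, hp⟩ := exists_seq_of_reflTransGen hab
    exact ⟨L, p, h0 ▸ ha, hL ▸ hb, hp⟩
  obtain ⟨p, h0, hL, hp⟩ := Nat.find_spec hex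
  have hmin : ∀ (M : ℕ) (q : ℕ → W), q 0 ∈ P → q M ∈ Q → (∀ i < M, r (q i) (q (i + 1))) →
      Nat.find hex ≤ M := fun M q h1 h2 h3 => Nat.find_min' hex ⟨q, h1, h2, h3⟩
  generalize Nat.find hex = L at *
  have hL0 : L ≠ 0 := by
    rintro rfl
    exact hne _ h0 _ hL rfl
  have hL1 : L ≠ 1 := by
    rintro rfl
    exact hadj _ h0 _ hL (hp 0 (by omega)).1
  have hL2 : L ≠ 2 := by
    rintro rfl
    have a1 := hp 0 (by omega)
    have a2 := hp 1 (by omega)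
    exact hcom _ h0 _ hL _ a1.2.2.1 a1.2.2.2 a1.1 a2.1
  have hT : ∀ i ≤ L, p i ∈ T ∧ p i ≠ v := by
    intro i hi
    rcases Nat.lt_or_eq_of_le hi with h | rfl
    · exact (hp i h).2.1
    · have := (hp (i - 1) (by omega)).2.2
      rwa [show i - 1 + 1 = i by omega] at this
  refine ⟨L, by omega, p, hT, ?_, ?_⟩
  · intro i j hij hj
    constructor
    · intro he
      -- A repeated vertex would allow the segment from `i` to `j` to be cut out; for `i = 0` the
      -- shortened path starts at `p j`.
      have h0' : (if 0 < i then p 0 else p (0 + (j - i))) ∈ P := by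
        split_ifs with h
        · exact h0
        · obtain rfl : i = 0 := by omega
          rw [show 0 + (j - 0) = j by omega, ← he]; exact h0
      have := hmin (L - (j - i)) (fun k => if k < i then p k else p (k + (j - i))) h0' ?_ ?_
      · omega
      · rw [if_neg (by omega), show L - (j - i) + (j - i) = L by omega]
        exact hL
      · intro k hk
        split_ifs with h1 h2
        · exact hp k (by omega)
        · obtain rfl : i = k + 1 := by omega
          rw [show k + 1 + (j - (k + 1)) = j by omega, ← he]
          exact hp k (by omega)
        · omega
        · rw [show k + 1 + (j - i) = k + (j - i) + 1 by omega]
          exact hp _ (by omega)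
    · constructor
      · intro ha
        by_contra hji
        have := hmin (L - (j - i - 1)) (fun k => if k ≤ i then p k else p (k + (j - i - 1)))
          (by simpa using h0) ?_ ?_
        · omega
        · rw [if_neg (by omega), show L - (j - i - 1) + (j - i - 1) = L by omega]
          exact hL
        · intro k hk
          split_ifs with h1 h2
          · exact hp k (by omega)
          · obtain rfl : k = i := by omega
            rw [show k + 1 + (j - k - 1) = j by omega]
            exact ⟨ha, hT _ (by omega), hT _ hj⟩
          · omega
          · rw [show k + 1 + (j - i - 1) = k + (j - i - 1) + 1 by omega]
            exact hp _ (by omega)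
      · rintro rfl
        exact (hp i (by omega)).1
  · intro i hi
    rw [hN _ (hT i hi).1]
    constructor
    -- An inner vertex in `P` could serve as an earlier start, one in `Q` as an earlier end; both
    -- contradict minimality.
    · rintro (h | h)
      · have := hmin (L - i) (fun k => p (k + i)) (by simpa using h)
          (by simpa [Nat.sub_add_cancel hi] using hL)
          (fun k hk => by
            rw [show k + 1 + i = k + i + 1 by omega]
            exact hp _ (by omega))
        omega
      · have := hmin i p h0 h (fun k hk => hp k (by omega))
        omega
    · rintro (rfl | rfl)
      exacts [Or.inl h0, Or.inr hL]

/-- The vertex `v` takes position `L + 1` and closes up the path `p 0, …, p L`. -/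
theorem cycleGraph_isIndContained_of_path {W : Type*} {A : SimpleGraph W} {T : Set W} {v : W}
    {L : ℕ} {p : ℕ → W} (hL : 1 ≤ L) (hvT : v ∈ T) (hT : ∀ i ≤ L, p i ∈ T ∧ p i ≠ v)
    (hp : ∀ i j, i < j → j ≤ L → p i ≠ p j ∧ (A.Adj (p i) (p j) ↔ j = i + 1))
    (hv : ∀ i ≤ L, A.Adj v (p i) ↔ i = 0 ∨ i = L) :
    SimpleGraph.cycleGraph (L + 2) ⊴ A.induce T := by
  have hmem : ∀ i, (if i ≤ L then p i else v) ∈ T := by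
    intro i
    split_ifs with h
    exacts [(hT i h).1, hvT]
  have key : ∀ i j, i < j → j < L + 2 → (if i ≤ L then p i else v) ≠ (if j ≤ L then p j else v) ∧
      (A.Adj (if i ≤ L then p i else v) (if j ≤ L then p j else v) ↔
        j = i + 1 ∨ (i = 0 ∧ j = L + 1)) := by
    intro i j hij hj
    rw [if_pos (by omega : i ≤ L)]
    split_ifs with h
    · have := hp i j hij h
      exact ⟨this.1, this.2.trans (by omega)⟩
    · refine ⟨(hT i (by omega)).2, ?_⟩
      rw [A.adj_comm, hv i (by omega)]
      omega
  have inj : Function.Injective fun i : Fin (L + 2) =>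
      (⟨if i.val ≤ L then p i.val else v, hmem _⟩ : T) := by
    intro i j hij
    rw [Subtype.mk.injEq] at hij
    by_contra hne
    rcases lt_or_gt_of_ne hne with h | h
    · exact (key i j h j.isLt).1 hij
    · exact (key j i h i.isLt).1 hij.symm
  refine ⟨⟨⟨_, inj⟩, ?_⟩⟩
  intro i j
  change A.Adj (if i.val ≤ L then p i.val else v) (if j.val ≤ L then p j.val else v) ↔ _
  rw [cycleGraph_adj_iff_val (by omega)]
  rcases lt_trichotomy i.val j.val with h | h | h
  · rw [(key i j h j.isLt).2]
    omega
  · rw [h]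
    simp only [SimpleGraph.irrefl, false_iff]
    omega
  · rw [A.adj_comm, (key j i h i.isLt).2]
    omega

theorem squareGrid_adj_iff (p q : ℤ × ℤ) : squareGrid.Adj p q ↔
    (q.1 = p.1 ∧ (q.2 = p.2 + 1 ∨ q.2 = p.2 - 1)) ∨
      (q.2 = p.2 ∧ (q.1 = p.1 + 1 ∨ q.1 = p.1 - 1)) := by
  change |p.1 - q.1| + |p.2 - q.2| = 1 ↔ _
  rcases abs_cases (p.1 - q.1) with h | h <;> rcases abs_cases (p.2 - q.2) with h' | h' <;> omega

/-- The grid has no induced 6-cycle. -/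
theorem squareGrid_no_induced_hexagon {a b c x y z : ℤ × ℤ} (hab : a ≠ b) (hbc : b ≠ c)
    (hac : a ≠ c) (hax : squareGrid.Adj a x) (hxb : squareGrid.Adj x b)
    (hby : squareGrid.Adj b y) (hyc : squareGrid.Adj y c) (hcz : squareGrid.Adj c z)
    (hza : squareGrid.Adj z a) (hay : ¬ squareGrid.Adj a y) (hbz : ¬ squareGrid.Adj b z)
    (hcx : ¬ squareGrid.Adj c x) : False := by
  obtain ⟨a1, a2⟩ := a
  obtain ⟨b1, b2⟩ := b
  obtain ⟨c1, c2⟩ := c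
  obtain ⟨x1, x2⟩ := x
  obtain ⟨y1, y2⟩ := y
  obtain ⟨z1, z2⟩ := z
  simp only [squareGrid_adj_iff, ne_eq, Prod.mk.injEq] at *
  -- A 6-cycle in the grid bounds two squares sharing an edge, and that edge joins opposite vertices
  -- of the cycle.
  rcases hax with ⟨h1, h2 | h2⟩ | ⟨h1, h2 | h2⟩ <;> rcases hza with ⟨h3, h4 | h4⟩ | ⟨h3, h4 | h4⟩ <;>
    rcases hxb with ⟨h5, h6 | h6⟩ | ⟨h5, h6 | h6⟩ <;> rcases hcz with ⟨h7, h8 | h8⟩ | ⟨h7, h8 | h8⟩ <;>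
    omega

/-! ### Linear forests on a line and bipartite interval graphs -/

/-- A nonempty finite set of vertices of an acyclic graph contains a vertex with at most one
neighbour in the set. -/
theorem exists_leaf_of_isAcyclic {V : Type*} {K : SimpleGraph V} (hK : K.IsAcyclic)
    {T : Finset V} (hT : T.Nonempty) :
    ∃ v ∈ T, ∀ a ∈ T, ∀ b ∈ T, K.Adj v a → K.Adj v b → a = b := by
  classical
  obtain ⟨v, hv⟩ := hT
  let H := K.induce (T : Set V)
  have hH : H.IsAcyclic := hK.induce _
  let C := H.connectedComponentMk ⟨v, hv⟩
  have htree := hH.isTree_connectedComponent C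
  have hmem : ∀ (z : C) (a : V) (ha : a ∈ T), K.Adj z.1.1 a →
      ∃ z' : C, z'.1.1 = a ∧ C.toSimpleGraph.Adj z z' := by
    rintro ⟨⟨z, hz⟩, hzC⟩ a ha hza
    have hadj : H.Adj ⟨z, hz⟩ ⟨a, ha⟩ := hza
    refine ⟨⟨⟨a, ha⟩, ?_⟩, rfl, hza⟩
    change H.connectedComponentMk _ = C at hzC
    change H.connectedComponentMk _ = C
    rw [← hzC]
    exact SimpleGraph.ConnectedComponent.sound hadj.reachable.symm
  by_cases hnt : Nontrivial C
  · have : Fintype C := Fintype.ofFinite _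
    obtain ⟨z, hz⟩ := htree.exists_vert_degree_one_of_nontrivial
    rw [SimpleGraph.degree_eq_one_iff_existsUnique_adj] at hz
    refine ⟨z.1.1, z.1.2, fun a ha b hb hza hzb => ?_⟩
    obtain ⟨a', rfl, ha'⟩ := hmem z a ha hza
    obtain ⟨b', rfl, hb'⟩ := hmem z b hb hzb
    rw [hz.unique ha' hb']
  · rw [not_nontrivial_iff_subsingleton] at hnt
    refine ⟨v, hv, fun a ha b hb hva hvb => ?_⟩
    obtain ⟨a', rfl, ha'⟩ := hmem ⟨⟨v, hv⟩, rfl⟩ a ha hva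
    exact absurd (Subsingleton.elim _ _) ha'.ne

/-- A finite linear forest can be laid out on a line, with adjacent vertices at consecutive
places and a prescribed end vertex last. -/
theorem exists_layout_with_last {V : Type*} {K : SimpleGraph V} (hK : K.IsAcyclic)
    (hdeg : ∀ v a b c, K.Adj v a → K.Adj v b → K.Adj v c → a = b ∨ a = c ∨ b = c) (n : ℕ) :
    ∀ (T : Finset V) (v : V), T.card = n → v ∈ T →
      (∀ a ∈ T, ∀ b ∈ T, K.Adj v a → K.Adj v b → a = b) →
      ∃ r : V → ℕ, Set.InjOn r T ∧ (∀ a ∈ T, r a ≤ r v) ∧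
        ∀ a ∈ T, ∀ b ∈ T, K.Adj a b → r a = r b + 1 ∨ r b = r a + 1 := by
  classical
  induction n with
  | zero =>
    intro T v hT hv
    simp [Finset.card_eq_zero.1 hT] at hv
  | succ n ih =>
    intro T v hT hv hleaf
    have hcard : (T.erase v).card = n := by rw [Finset.card_erase_of_mem hv, hT]; rfl
    obtain hempty | hne := (T.erase v).eq_empty_or_nonempty
    · have hTv : ∀ a ∈ T, a = v := fun a ha => by
        by_contra h
        have : a ∈ T.erase v := Finset.mem_erase.2 ⟨h, ha⟩
        simp [hempty] at this
      refine ⟨fun _ => 0, fun a ha b hb _ => (hTv a ha).trans (hTv b hb).symm, by simp, ?_⟩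
      intro a ha b hb hab
      exact absurd ((hTv a ha).trans (hTv b hb).symm) hab.ne
    -- The vertex to be placed just before `v` is its neighbour in `T`, which becomes a leaf once
    -- `v` is removed, or any leaf of the rest if `v` has no neighbour.
    · obtain ⟨u, hu, hul, huv⟩ : ∃ u ∈ T.erase v,
          (∀ a ∈ T.erase v, ∀ b ∈ T.erase v, K.Adj u a → K.Adj u b → a = b) ∧
          ∀ a ∈ T, K.Adj v a → a = u := by
        by_cases h : ∃ u ∈ T, K.Adj v u
        · obtain ⟨u, hu, hvu⟩ := h
          refine ⟨u, Finset.mem_erase.2 ⟨hvu.ne', hu⟩, fun a ha b hb hua hub => ?_,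
            fun a ha hva => hleaf a ha u hu hva hvu⟩
          rcases hdeg u a b v hua hub hvu.symm with h | h | h
          · exact h
          · exact absurd h (Finset.ne_of_mem_erase ha)
          · exact absurd h (Finset.ne_of_mem_erase hb)
        · obtain ⟨u, hu, hul⟩ := exists_leaf_of_isAcyclic hK hne
          exact ⟨u, hu, hul, fun a ha hva => absurd ⟨a, ha, hva⟩ h⟩
      obtain ⟨r, hinj, hmax, hadj⟩ := ih (T.erase v) u hcard hu hul
      have hr : ∀ a ∈ T, a ≠ v → Function.update r v (r u + 1) a = r a := fun a _ h =>
        Function.update_of_ne h _ _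
      have hrv : Function.update r v (r u + 1) v = r u + 1 := Function.update_self _ _ _
      have hlt : ∀ a ∈ T, a ≠ v → r a ≤ r u := fun a ha h => hmax a (Finset.mem_erase.2 ⟨h, ha⟩)
      refine ⟨Function.update r v (r u + 1), ?_, ?_, ?_⟩
      · intro a ha b hb hab
        by_cases h1 : a = v <;> by_cases h2 : b = v
        · rw [h1, h2]
        · rw [h1, hrv, hr b hb h2] at hab
          have := hlt b hb h2
          omega
        · rw [h2, hrv, hr a ha h1] at hab
          have := hlt a ha h1
          omega
        · rw [hr a ha h1, hr b hb h2] at hab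
          exact hinj (by simpa using ⟨ha, h1⟩) (by simpa using ⟨hb, h2⟩) hab
      · intro a ha
        by_cases h1 : a = v
        · rw [h1]
        · rw [hrv, hr a ha h1]
          exact (hlt a ha h1).trans (Nat.le_succ _)
      · intro a ha b hb hab
        by_cases h1 : a = v <;> by_cases h2 : b = v
        · exact absurd (h1.trans h2.symm) hab.ne
        · subst h1
          rw [hrv, hr b hb h2, huv b hb hab]
          exact Or.inl rfl
        · subst h2
          rw [hrv, hr a ha h1, huv a ha hab.symm]
          exact Or.inr rfl
        · rw [hr a ha h1, hr b hb h2]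
          exact hadj a (Finset.mem_erase.2 ⟨h1, ha⟩) b (Finset.mem_erase.2 ⟨h2, hb⟩) hab

theorem exists_layout {V : Type*} {K : SimpleGraph V} (hK : K.IsAcyclic)
    (hdeg : ∀ v a b c, K.Adj v a → K.Adj v b → K.Adj v c → a = b ∨ a = c ∨ b = c)
    (T : Finset V) : ∃ r : V → ℕ, Set.InjOn r T ∧
      ∀ a ∈ T, ∀ b ∈ T, K.Adj a b → r a = r b + 1 ∨ r b = r a + 1 := by
  obtain rfl | hne := T.eq_empty_or_nonempty
  · exact ⟨fun _ => 0, by simp, by simp⟩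
  · obtain ⟨v, hv, hleaf⟩ := exists_leaf_of_isAcyclic hK hne
    obtain ⟨r, h1, -, h3⟩ := exists_layout_with_last hK hdeg _ T v rfl hv hleaf
    exact ⟨r, h1, h3⟩

/-- A bipartite intersection graph of intervals has an interval model. -/
theorem hasIntervalModel_of_bipartite_intervals {V : Type*} [Finite V] {G : SimpleGraph V}
    (A : V → Prop) (s e : V → ℕ)
    (h : ∀ u v, G.Adj u v ↔ ¬ (A u ↔ A v) ∧ s u ≤ e v ∧ s v ≤ e u) : HasIntervalModel G := by
  classical
  have := Fintype.ofFinite V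
  obtain ⟨M, ⟨φ⟩⟩ := Finite.exists_equiv_fin V
  -- One class is labelled by left ends, the other by right ends. The odd keys place a left end
  -- before an equal right end, and `φ` separates equal keys. The order of labels then encodes one
  -- of the two inequalities for meeting, and the model intervals below encode the other.
  let k : V → ℕ := fun v => if A v then 2 * s v else 2 * e v + 1
  have hk : ∀ u v, k u < k v → k u * M + (φ u).val < k v * M + (φ v).val := by
    intro u v huv
    have h1 : (k u + 1) * M ≤ k v * M := Nat.mul_le_mul_right _ huv
    have h2 := (φ u).isLt
    rw [add_mul, one_mul] at h1
    omega
  have hB : ∀ v, e v ≤ ∑ u, e u := fun v =>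
    Finset.single_le_sum (f := e) (fun _ _ => Nat.zero_le _) (Finset.mem_univ v)
  generalize (∑ u, e u) = B at hB
  refine ⟨fun v => k v * M + (φ v).val, fun v => if A v then e v + 1 else 0,
    fun v => if A v then B + 1 else s v, ?_, ?_, ?_⟩
  · intro u v huv
    rcases lt_trichotomy (k u) (k v) with h | h | h
    · exact absurd huv (hk u v h).ne
    · exact φ.injective (Fin.ext (by simpa [h] using huv))
    · exact absurd huv (hk v u h).ne'
  · intro v
    have := hB v
    beta_reduce
    split_ifs <;> omega
  · intro x y hxy
    have hle : k x ≤ k y := by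
      by_contra! hlt
      exact absurd hxy (hk y x hlt).not_gt
    have := hB x
    rw [h]
    by_cases hx : A x <;> by_cases hy : A y <;> simp only [hx, hy, if_true, if_false, k] at * <;>
      simp <;> omega

/-! ### Links between unit squares form no cycle -/

theorem mem_unitSquare {c p : ℤ × ℤ} :
    p ∈ unitSquare c ↔ (p.1 = c.1 ∨ p.1 = c.1 + 1) ∧ (p.2 = c.2 ∨ p.2 = c.2 + 1) := by
  obtain ⟨p1, p2⟩ := p
  simp only [unitSquare, Finset.mem_insert, Finset.mem_singleton, Prod.mk.injEq]
  omega

/-- The link graph of the unit squares (given by their lower left corners) contained in `S`: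
two squares are linked if they share an edge, or if they share only a corner and neither of the
two squares sharing an edge with both of them is contained in `S`. -/
def linkGraph (S : Finset (ℤ × ℤ)) : SimpleGraph (ℤ × ℤ) where
  Adj c d := c ≠ d ∧ unitSquare c ⊆ S ∧ unitSquare d ⊆ S ∧
    (c.1 ≤ d.1 + 1 ∧ d.1 ≤ c.1 + 1 ∧ c.2 ≤ d.2 + 1 ∧ d.2 ≤ c.2 + 1) ∧
    (c.1 = d.1 ∨ c.2 = d.2 ∨ (¬ unitSquare (c.1, d.2) ⊆ S ∧ ¬ unitSquare (d.1, c.2) ⊆ S))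
  symm := ⟨fun c d ⟨h1, h2, h3, h4, h5⟩ => ⟨h1.symm, h3, h2, by omega, by
    rcases h5 with h | h | h
    exacts [Or.inl h.symm, Or.inr (Or.inl h.symm), Or.inr (Or.inr h.symm)]⟩⟩
  loopless := ⟨fun c h => h.1 rfl⟩

theorem even_add_of_squareGrid_adj {p q : ℤ × ℤ} (h : squareGrid.Adj p q) :
    (q.1 + q.2) % 2 = (p.1 + p.2 + 1) % 2 := by
  rw [squareGrid_adj_iff] at h
  omega

/-- In a set of grid points without long induced even cycles, two parts of the neighbourhood of
a point that are not joined by a path of length two avoiding it are not joined by any path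
avoiding it. -/
theorem not_reflTransGen_of_no_cycle {S : Finset (ℤ × ℤ)}
    (hC : ∀ n, 4 ≤ n → ¬ SimpleGraph.cycleGraph (2 * n) ⊴ squareGrid.induce (S : Set (ℤ × ℤ)))
    {T : Set (ℤ × ℤ)} (hTS : T ⊆ S) {v : ℤ × ℤ} {P Q : Set (ℤ × ℤ)}
    (hvT : v ∈ T) (hN : ∀ x ∈ T, squareGrid.Adj v x ↔ x ∈ P ∨ x ∈ Q)
    (hne : ∀ p ∈ P, ∀ q ∈ Q, p ≠ q) (hadj : ∀ p ∈ P, ∀ q ∈ Q, ¬ squareGrid.Adj p q)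
    (hcom : ∀ p ∈ P, ∀ q ∈ Q, ∀ x ∈ T, x ≠ v → squareGrid.Adj p x → ¬ squareGrid.Adj x q)
    {p q : ℤ × ℤ} (hp : p ∈ P) (hq : q ∈ Q) : ¬ Relation.ReflTransGen
      (fun a b => squareGrid.Adj a b ∧ (a ∈ T ∧ a ≠ v) ∧ (b ∈ T ∧ b ≠ v)) p q := by
  intro hpath
  obtain ⟨L, hL, f, hT, hf, hv⟩ :=
    exists_induced_cycle hN hne hadj hcom ⟨p, hp, q, hq, hpath⟩
  have hcyc := cycleGraph_isIndContained_of_path (by omega) hvT hT hf hv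
  -- The grid is bipartite, so `L` is even; with `3 ≤ L` and `L ≠ 4`, the cycle length `L + 2` is at
  -- least 8.
  have hpar : ∀ i ≤ L, ((f i).1 + (f i).2) % 2 = ((f 0).1 + (f 0).2 + i) % 2 := by
    intro i
    induction i with
    | zero => simp
    | succ i ih =>
      intro hi
      have h1 := ih (by omega)
      have h2 := even_add_of_squareGrid_adj (((hf i (i + 1) (by omega) hi).2).2 rfl)
      push_cast
      omega
  have h0 := (hv 0 (by omega)).2 (Or.inl rfl)
  have h1 := (hv L le_rfl).2 (Or.inr rfl)
  have h2 := hpar L le_rfl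
  have e0 := even_add_of_squareGrid_adj h0
  have e1 := even_add_of_squareGrid_adj h1
  have hL4 : L ≠ 4 := by
    rintro rfl
    exact squareGrid_no_induced_hexagon (hT 1 (by omega)).2.symm
      (hf 1 3 (by omega) (by omega)).1 (hT 3 (by omega)).2.symm h0
      ((hf 0 1 (by omega) (by omega)).2.2 rfl) ((hf 1 2 (by omega) (by omega)).2.2 rfl)
      ((hf 2 3 (by omega) (by omega)).2.2 rfl) ((hf 3 4 (by omega) (by omega)).2.2 rfl)
      h1.symm (fun h => by have := (hv 2 (by omega)).1 h; omega)
      (fun h => by have := (hf 1 4 (by omega) (by omega)).2.1 h; omega)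
      (fun h => by have := (hf 0 3 (by omega) (by omega)).2.1 h.symm; omega)
  refine hC (L / 2 + 1) (by omega) ?_
  rw [show 2 * (L / 2 + 1) = L + 2 by omega]
  exact hcyc.trans ⟨⟨⟨Set.inclusion hTS, Set.inclusion_injective hTS⟩, Iff.rfl⟩⟩

/-- Opposite corners of a square are joined by two paths, at most one of which passes through `b`.
-/
theorem reflTransGen_of_mem_unitSquare {r : ℤ × ℤ → ℤ × ℤ → Prop} {c b : ℤ × ℤ}
    (hr : ∀ p ∈ unitSquare c, ∀ q ∈ unitSquare c, p ≠ b → q ≠ b → squareGrid.Adj p q → r p q)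
    {p q : ℤ × ℤ} (hp : p ∈ unitSquare c) (hq : q ∈ unitSquare c) (hpb : p ≠ b) (hqb : q ≠ b) :
    Relation.ReflTransGen r p q := by
  by_cases hpq : p = q
  · rw [hpq]
  by_cases hadj : squareGrid.Adj p q
  · exact .single (hr p hp q hq hpb hqb hadj)
  obtain ⟨z, hz, hzb, h1, h2⟩ : ∃ z ∈ unitSquare c, z ≠ b ∧ squareGrid.Adj p z ∧
      squareGrid.Adj z q := by
    have h1 : q.1 ≠ p.1 ∧ q.2 ≠ p.2 := by
      rw [mem_unitSquare] at hp hq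
      rw [Prod.ext_iff] at hpq
      rw [squareGrid_adj_iff] at hadj
      omega
    rw [mem_unitSquare] at hp hq
    by_cases h : (p.1, q.2) = b
    · refine ⟨(q.1, p.2), mem_unitSquare.2 ⟨hq.1, hp.2⟩, ?_, ?_, ?_⟩
      · rintro rfl
        exact h1.1 (congrArg Prod.fst h).symm
      · rw [squareGrid_adj_iff]; dsimp only; omega
      · rw [squareGrid_adj_iff]; dsimp only; omega
    · refine ⟨(p.1, q.2), mem_unitSquare.2 ⟨hp.1, hq.2⟩, h, ?_, ?_⟩
      · rw [squareGrid_adj_iff]; dsimp only; omega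
      · rw [squareGrid_adj_iff]; dsimp only; omega
  exact .tail (.single (hr p hp z hz hpb hzb h1)) (hr z hz q hq hzb hqb h2)

/-- Consecutive squares sharing points other than `b` have all their points other than `b`
connected to each other. -/
theorem reflTransGen_of_squares {r : ℤ × ℤ → ℤ × ℤ → Prop} {b : ℤ × ℤ} {e : ℕ → ℤ × ℤ} (m : ℕ)
    (hr : ∀ i ≤ m, ∀ p ∈ unitSquare (e i), ∀ q ∈ unitSquare (e i), p ≠ b → q ≠ b →
      squareGrid.Adj p q → r p q)
    (hshare : ∀ i < m, ∃ p, p ∈ unitSquare (e i) ∧ p ∈ unitSquare (e (i + 1)) ∧ p ≠ b)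
    {p q : ℤ × ℤ} (hp : p ∈ unitSquare (e 0)) (hq : q ∈ unitSquare (e m)) (hpb : p ≠ b)
    (hqb : q ≠ b) : Relation.ReflTransGen r p q := by
  induction m generalizing q with
  | zero => exact reflTransGen_of_mem_unitSquare (hr 0 le_rfl) hp hq hpb hqb
  | succ m ih =>
    obtain ⟨z, hz, hz', hzb⟩ := hshare m (by omega)
    exact (ih (fun i hi => hr i (by omega)) (fun i hi => hshare i (by omega)) hz hzb).trans
      (reflTransGen_of_mem_unitSquare (hr _ le_rfl) hz' hq hzb hqb)

theorem linkGraph_exists_shared {S : Finset (ℤ × ℤ)} {c d : ℤ × ℤ} (h : (linkGraph S).Adj c d)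
    (b : ℤ × ℤ) : (∃ p, p ∈ unitSquare c ∧ p ∈ unitSquare d ∧ p ≠ b) ∨
      (c.1 ≠ d.1 ∧ c.2 ≠ d.2 ∧ b ∈ unitSquare c ∧ b ∈ unitSquare d) := by
  obtain ⟨h1, -, -, h2, -⟩ := h
  obtain ⟨c1, c2⟩ := c
  obtain ⟨d1, d2⟩ := d
  obtain ⟨b1, b2⟩ := b
  simp only [ne_eq, Prod.mk.injEq, mem_unitSquare, Prod.exists] at *
  -- The candidates are the lower left and upper right corners of the common part; both equal `b`
  -- only if the squares meet in `b` alone.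
  by_cases e1 : max c1 d1 = b1 ∧ max c2 d2 = b2
  · by_cases e2 : min c1 d1 + 1 = b1 ∧ min c2 d2 + 1 = b2
    · right; omega
    · left; exact ⟨min c1 d1 + 1, min c2 d2 + 1, by omega, by omega, e2⟩
  · left; exact ⟨max c1 d1, max c2 d2, by omega, by omega, e1⟩

/-- The squares of a chain lie lexicographically (row first) after the square at `(x, y)`. -/
def ChainAfter (S : Finset (ℤ × ℤ)) (x y : ℤ) (e : ℕ → ℤ × ℤ) (m : ℕ) : Prop :=
  (∀ i < m, (linkGraph S).Adj (e i) (e (i + 1))) ∧ (∀ i ≤ m, unitSquare (e i) ⊆ S) ∧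
    ∀ i ≤ m, e i ≠ (x, y) ∧ y ≤ (e i).2 ∧ ((e i).2 = y → x ≤ (e i).1)

theorem ChainAfter.reverse {S : Finset (ℤ × ℤ)} {x y : ℤ} {e : ℕ → ℤ × ℤ} {m : ℕ}
    (h : ChainAfter S x y e m) : ChainAfter S x y (fun i => e (m - i)) m := by
  refine ⟨fun i hi => ?_, fun i _ => h.2.1 _ (by omega), fun i _ => h.2.2 _ (by omega)⟩
  have := h.1 (m - (i + 1)) (by omega)
  rw [show m - (i + 1) + 1 = m - i by omega] at this
  exact this.symm

theorem unitSquare_subset_iff {S : Finset (ℤ × ℤ)} {x y : ℤ} : unitSquare (x, y) ⊆ S ↔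
    (x, y) ∈ S ∧ (x + 1, y) ∈ S ∧ (x, y + 1) ∈ S ∧ (x + 1, y + 1) ∈ S := by
  simp [unitSquare, Finset.insert_subset_iff]

/-- The two missing squares make the corner `(x, y + 1)` the only short connection between its
neighbours in the square `(x, y)` and those in the upper left square. The chain joins the two groups
while avoiding that corner, so a long induced cycle passes through it. -/
theorem not_chainAfter_right_left {S : Finset (ℤ × ℤ)}
    (hC : ∀ n, 4 ≤ n → ¬ SimpleGraph.cycleGraph (2 * n) ⊴ squareGrid.induce (S : Set (ℤ × ℤ)))
    {x y : ℤ} {e : ℕ → ℤ × ℤ} {m : ℕ} (h : ChainAfter S x y e m) (hc : unitSquare (x, y) ⊆ S)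
    (h0 : e 0 = (x + 1, y)) (hm : e m = (x - 1, y + 1))
    (hW : ¬ unitSquare (x - 1, y) ⊆ S) (hN : ¬ unitSquare (x, y + 1) ⊆ S) : False := by
  obtain ⟨hlink, hcell, hlex⟩ := h
  have hcell0 := h0 ▸ hcell 0 (by omega)
  have hcellm := hm ▸ hcell m le_rfl
  rw [unitSquare_subset_iff] at hc hcell0 hcellm hW hN
  simp only [sub_add_cancel] at hW hcellm
  have m1 : (x - 1, y) ∉ S := fun h => hW ⟨h, hc.1, hcellm.1, hc.2.2.1⟩
  have m2 : (x + 1, y + 1 + 1) ∉ S := fun h => hN ⟨hc.2.2.1, hc.2.2.2, hcellm.2.2.2, h⟩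
  refine not_reflTransGen_of_no_cycle hC (T := (S : Set (ℤ × ℤ))) subset_rfl (v := (x, y + 1))
    (P := {(x, y), (x + 1, y + 1)}) (Q := {(x - 1, y + 1), (x, y + 1 + 1)})
    (by simpa using hc.2.2.1) ?_ ?_ ?_ ?_ (p := (x + 1, y + 1)) (q := (x, y + 1 + 1)) (by simp)
    (by simp) ?_
  · rintro ⟨u, w⟩ hu
    simp only [squareGrid_adj_iff, Set.mem_insert_iff, Set.mem_singleton_iff, Prod.mk.injEq]
    omega
  · simp only [Set.mem_insert_iff, Set.mem_singleton_iff]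
    rintro _ (rfl | rfl) _ (rfl | rfl) <;> simp <;> omega
  · simp only [Set.mem_insert_iff, Set.mem_singleton_iff]
    rintro _ (rfl | rfl) _ (rfl | rfl) <;> simp only [squareGrid_adj_iff] <;> omega
  · simp only [Set.mem_insert_iff, Set.mem_singleton_iff]
    rintro _ hp _ hq ⟨u, w⟩ hu hv h1 h2
    have e1 : ¬ (u = x - 1 ∧ w = y) := by rintro ⟨rfl, rfl⟩; exact m1 hu
    have e2 : ¬ (u = x + 1 ∧ w = y + 1 + 1) := by rintro ⟨rfl, rfl⟩; exact m2 hu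
    simp only [squareGrid_adj_iff, ne_eq, Prod.mk.injEq] at *
    rcases hp with rfl | rfl <;> rcases hq with rfl | rfl <;> simp only at h1 h2 <;> omega
  · refine reflTransGen_of_squares (b := (x, y + 1)) (e := e) m ?_ ?_ (by simp [h0, mem_unitSquare])
      (by simp [hm, mem_unitSquare]) (by simp) (by simp)
    · intro i hi p hp q hq hpb hqb hpq
      exact ⟨hpq, ⟨hcell i hi hp, hpb⟩, ⟨hcell i hi hq, hqb⟩⟩
    · intro i hi
      have hl := hlink i hi
      refine (linkGraph_exists_shared hl (x, y + 1)).resolve_right ?_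
      rintro ⟨a1, a2, a3, a4⟩
      have b1 := hlex i hi.le
      have b2 := hlex (i + 1) hi
      have b3 := hcell i hi.le
      have b4 := hcell (i + 1) hi
      have key : ∀ d : ℤ × ℤ, unitSquare d ⊆ S → d ≠ (x, y) → (x, y + 1) ∈ unitSquare d →
          d = (x - 1, y + 1) := by
        rintro ⟨d1, d2⟩ hd hne hmem
        simp only [mem_unitSquare, ne_eq, Prod.mk.injEq] at *
        by_contra hcon
        rcases (by omega : (d1 = x - 1 ∧ d2 = y) ∨ (d1 = x ∧ d2 = y + 1)) with ⟨rfl, rfl⟩ | ⟨rfl, rfl⟩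
        · rw [unitSquare_subset_iff] at hd
          exact m1 hd.1
        · rw [unitSquare_subset_iff] at hd
          exact m2 hd.2.2.2
      rw [key _ b3 b1.1 a3, key _ b4 b2.1 a4] at a1
      exact a1 rfl

/-- The induced cycle passes through the lower left corner `(x, y)`. The opposite corner is deleted,
being the short connection between its right and upper neighbours; the other two neighbours are
deleted too, and no square of the chain contains them. Two consecutive squares cannot meet only in
the deleted corner: they would be the right and upper squares, whose link `(x, y)` prevents. -/
theorem not_chainAfter_right_up {S : Finset (ℤ × ℤ)}
    (hC : ∀ n, 4 ≤ n → ¬ SimpleGraph.cycleGraph (2 * n) ⊴ squareGrid.induce (S : Set (ℤ × ℤ)))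
    {x y : ℤ} {e : ℕ → ℤ × ℤ} {m : ℕ} (h : ChainAfter S x y e m) (hc : unitSquare (x, y) ⊆ S)
    (h0 : e 0 = (x + 1, y)) (hm : e m = (x, y + 1)) : False := by
  obtain ⟨hlink, hcell, hlex⟩ := h
  have hc' := unitSquare_subset_iff.1 hc
  refine not_reflTransGen_of_no_cycle hC
    (T := {p | p ∈ S ∧ p ≠ (x + 1, y + 1) ∧ p ≠ (x - 1, y) ∧ p ≠ (x, y - 1)})
    (fun p hp => hp.1) (v := (x, y)) (P := {(x + 1, y)}) (Q := {(x, y + 1)})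
    (by simp [hc'.1]; omega) ?_ ?_ ?_ ?_ (p := (x + 1, y)) (q := (x, y + 1)) rfl rfl ?_
  · rintro ⟨u, w⟩ ⟨-, h1, h2, h3⟩
    simp only [squareGrid_adj_iff, Set.mem_singleton_iff, ne_eq, Prod.mk.injEq] at *
    omega
  · rintro _ rfl _ rfl; simp
  · rintro _ rfl _ rfl; simp only [squareGrid_adj_iff]; omega
  · rintro _ rfl _ rfl ⟨u, w⟩ ⟨-, h1, h2, h3⟩ h4 h5 h6
    simp only [squareGrid_adj_iff, ne_eq, Prod.mk.injEq] at *
    omega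
  · refine reflTransGen_of_squares (b := (x + 1, y + 1)) (e := e) m ?_ ?_
      (by simp [h0, mem_unitSquare]) (by simp [hm, mem_unitSquare]) (by simp) (by simp)
    · intro i hi p hp q hq hpb hqb hpq
      have hl := hlex i hi
      have key : ∀ p ∈ unitSquare (e i), p ≠ (x - 1, y) ∧ p ≠ (x, y - 1) ∧ p ≠ (x, y) := by
        rintro ⟨p1, p2⟩ hp
        generalize e i = d at *
        obtain ⟨d1, d2⟩ := d
        simp only [mem_unitSquare, ne_eq, Prod.mk.injEq] at *
        omega
      have k1 := key p hp
      have k2 := key q hq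
      exact ⟨hpq, ⟨⟨hcell i hi hp, hpb, k1.1, k1.2.1⟩, k1.2.2⟩,
        ⟨⟨hcell i hi hq, hqb, k2.1, k2.2.1⟩, k2.2.2⟩⟩
    · intro i hi
      have hl := hlink i hi
      refine (linkGraph_exists_shared hl (x + 1, y + 1)).resolve_right ?_
      rintro ⟨a1, a2, a3, a4⟩
      have b1 := (hlex i hi.le).1
      have b2 := (hlex (i + 1) hi).1
      have h5 := hl.2.2.2.2.resolve_left a1 |>.resolve_left a2
      generalize e i = d at *
      generalize e (i + 1) = d' at *
      obtain ⟨d1, d2⟩ := d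
      obtain ⟨d1', d2'⟩ := d'
      simp only [mem_unitSquare, ne_eq, Prod.mk.injEq] at *
      rcases (by omega : (d1 = x ∧ d2' = y) ∨ (d1' = x ∧ d2 = y)) with ⟨rfl, rfl⟩ | ⟨rfl, rfl⟩
      exacts [h5.1 hc, h5.2 hc]

/-- At the leftmost square of the lowest row of a cycle, the next and previous squares lie to the
right, above, or diagonally above. Links across a corner exclude the squares between, which leaves
only the pairs right-up and right-upper-left. -/
theorem linkGraph_isAcyclic {S : Finset (ℤ × ℤ)}
    (hC : ∀ n, 4 ≤ n → ¬ SimpleGraph.cycleGraph (2 * n) ⊴ squareGrid.induce (S : Set (ℤ × ℤ))) :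
    (linkGraph S).IsAcyclic := by
  intro u w hw
  obtain ⟨c, hc, hmin⟩ := w.support.toFinset.exists_min_image (fun c => toLex (c.2, c.1))
    ⟨u, by simp⟩
  rw [List.mem_toFinset] at hc
  obtain ⟨w', hw', hmin'⟩ : ∃ w' : (linkGraph S).Walk c c, w'.IsCycle ∧
      ∀ d ∈ w'.support, toLex (c.2, c.1) ≤ toLex (d.2, d.1) := by
    refine ⟨w.rotate c hc, hw.rotate hc, fun d hd => hmin d ?_⟩
    rw [List.mem_toFinset]
    exact (SimpleGraph.Walk.mem_support_rotate_iff ..).1 hd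
  obtain ⟨x, y⟩ := c
  have hn : 3 ≤ w'.length := by
    exact hw'.three_le_length
  have hlink : ∀ i < w'.length, (linkGraph S).Adj (w'.getVert i) (w'.getVert (i + 1)) :=
    fun i hi => w'.adj_getVert_succ hi
  have hlex : ∀ i, y ≤ (w'.getVert i).2 ∧ ((w'.getVert i).2 = y → x ≤ (w'.getVert i).1) := by
    intro i
    have := hmin' _ (w'.getVert_mem_support i)
    rw [Prod.Lex.toLex_le_toLex] at this
    simp only at this
    omega
  have hne : ∀ i, 1 ≤ i → i < w'.length → w'.getVert i ≠ (x, y) := by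
    intro i h1 h2 he
    have h3 : w'.getVert i = w'.getVert w'.length := by rw [he, w'.getVert_length]
    have := hw'.getVert_injOn ⟨h1, h2.le⟩ ⟨by omega, le_rfl⟩ h3
    omega
  have hfirst := hlink 0 (by omega)
  have hlast := hlink (w'.length - 1) (by omega)
  rw [show w'.length - 1 + 1 = w'.length by omega, w'.getVert_length] at hlast
  rw [w'.getVert_zero] at hfirst
  have hdiff : w'.getVert 1 ≠ w'.getVert (w'.length - 1) := fun he => by
    have := hw'.getVert_injOn ⟨le_rfl, by omega⟩ ⟨by omega, by omega⟩ he
    omega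
  obtain ⟨e, hchain, e0, em⟩ : ∃ e, ChainAfter S x y e (w'.length - 2) ∧ e 0 = w'.getVert 1 ∧
      e (w'.length - 2) = w'.getVert (w'.length - 2 + 1) :=
    ⟨fun i => w'.getVert (i + 1), ⟨fun i hi => hlink _ (by omega),
      fun i hi => (hlink (i + 1) (by omega)).2.1,
      fun i hi => ⟨hne _ (by omega) (by omega), hlex _⟩⟩, rfl, rfl⟩
  have hx1 := hlex 1
  have hx2 := hlex (w'.length - 1)
  have hlast' : (linkGraph S).Adj (x, y) (w'.getVert (w'.length - 2 + 1)) := by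
    rw [show w'.length - 2 + 1 = w'.length - 1 by omega]; exact hlast.symm
  rw [show w'.length - 1 = w'.length - 2 + 1 by omega] at hx2 hdiff
  have hcell := hfirst.2.1
  generalize w'.length - 2 = m at *
  generalize w'.getVert 1 = a at *
  generalize w'.getVert (m + 1) = b at *
  have cases : ∀ d : ℤ × ℤ, (linkGraph S).Adj (x, y) d → y ≤ d.2 ∧ (d.2 = y → x ≤ d.1) →
      unitSquare d ⊆ S ∧ (d = (x + 1, y) ∨ d = (x, y + 1) ∨
        (d = (x + 1, y + 1) ∧ ¬ unitSquare (x, y + 1) ⊆ S ∧ ¬ unitSquare (x + 1, y) ⊆ S) ∨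
        (d = (x - 1, y + 1) ∧ ¬ unitSquare (x, y + 1) ⊆ S ∧ ¬ unitSquare (x - 1, y) ⊆ S)) := by
    rintro ⟨d1, d2⟩ ⟨h1, -, h2, h3, h4⟩ h5
    refine ⟨h2, ?_⟩
    simp only [ne_eq, Prod.mk.injEq] at *
    rcases (by omega : (d1 = x + 1 ∧ d2 = y) ∨ (d1 = x ∧ d2 = y + 1) ∨ (d1 = x + 1 ∧ d2 = y + 1) ∨
      (d1 = x - 1 ∧ d2 = y + 1)) with ⟨rfl, rfl⟩ | ⟨rfl, rfl⟩ | ⟨rfl, rfl⟩ | ⟨rfl, rfl⟩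
    · simp
    · simp
    · exact Or.inr (Or.inr (Or.inl ⟨⟨rfl, rfl⟩, h4.resolve_left (by omega) |>.resolve_left
        (by omega)⟩))
    · exact Or.inr (Or.inr (Or.inr ⟨⟨rfl, rfl⟩, h4.resolve_left (by omega) |>.resolve_left
        (by omega)⟩))
  -- The upper square has its lower corners in the current square and one upper corner in each
  -- diagonal square.
  have hfill : unitSquare (x + 1, y + 1) ⊆ S → unitSquare (x - 1, y + 1) ⊆ S →
      unitSquare (x, y + 1) ⊆ S := by
    simp only [unitSquare_subset_iff, sub_add_cancel] at hcell ⊢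
    tauto
  obtain ⟨ca, ha⟩ := cases a hfirst hx1
  obtain ⟨cb, hb⟩ := cases b hlast' hx2
  obtain ⟨e', hrev, r0, rm⟩ : ∃ e', ChainAfter S x y e' m ∧ e' 0 = b ∧ e' m = a :=
    ⟨_, hchain.reverse, by simpa using em, by simpa using e0⟩
  rcases ha with rfl | rfl | ⟨rfl, ha1, ha2⟩ | ⟨rfl, ha1, ha2⟩ <;>
    rcases hb with rfl | rfl | ⟨rfl, hb1, hb2⟩ | ⟨rfl, hb1, hb2⟩ <;>
    first
    | exact hdiff rfl
    | contradiction
    | exact not_chainAfter_right_up hC hchain hcell e0 em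
    | exact not_chainAfter_right_up hC hrev hcell r0 rm
    | exact not_chainAfter_right_left hC hchain hcell e0 em hb2 hb1
    | exact not_chainAfter_right_left hC hrev hcell r0 rm ha2 ha1
    | exact ha1 (hfill ca cb)
    | exact ha1 (hfill cb ca)

/-! ### Without a copy of `graphX`, a square has at most two links -/

/-- The drawing of `graphX` in the grid. -/
def graphXPoint : Fin 9 → ℤ × ℤ :=
  ![(-1, 0), (0, 0), (0, 1), (0, 2), (1, 2), (1, 1), (1, 0), (2, 0), (2, 1)]

theorem squareGrid_adj_graphXPoint (i j : Fin 9) :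
    squareGrid.Adj (graphXPoint i) (graphXPoint j) ↔ graphX.Adj i j := by
  rw [squareGrid_adj_iff]
  simp only [graphX, SimpleGraph.fromEdgeSet_adj, Set.mem_insert_iff, Set.mem_singleton_iff]
  revert i j
  decide

/-- A copy of `graphX` in a union of four unit squares contained in `S`. -/
theorem graphX_isIndContained_of_squares {S : Finset (ℤ × ℤ)} (φ : ℤ × ℤ → ℤ × ℤ)
    {c₀ c₁ c₂ d : ℤ × ℤ} (h₀ : unitSquare c₀ ⊆ S) (h₁ : unitSquare c₁ ⊆ S)
    (h₂ : unitSquare c₂ ⊆ S) (h₃ : unitSquare d ⊆ S)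
    (hφ : ∀ p q, squareGrid.Adj (φ p) (φ q) ↔ squareGrid.Adj p q)
    (hinj : ∀ p q, φ p = φ q → p.1 = q.1 ∧ p.2 = q.2)
    (hφ₀ : ∀ p ∈ unitSquare (0, 0), φ p ∈ unitSquare c₀)
    (hφ₁ : ∀ p ∈ unitSquare (1, 0), φ p ∈ unitSquare c₁)
    (hφ₂ : ∀ p ∈ unitSquare (0, 1), φ p ∈ unitSquare c₂)
    (hφ₃ : φ (-1, 0) ∈ unitSquare d) :
    graphX ⊴ squareGrid.induce (S : Set (ℤ × ℤ)) := by
  have hi : Function.Injective graphXPoint := by decide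
  have hmem : ∀ k, φ (graphXPoint k) ∈ S := by
    have hk : ∀ k, graphXPoint k = (-1, 0) ∨ graphXPoint k ∈ unitSquare (0, 0) ∨
        graphXPoint k ∈ unitSquare (1, 0) ∨ graphXPoint k ∈ unitSquare (0, 1) := by decide
    intro k
    rcases hk k with h | h | h | h
    exacts [h ▸ h₃ hφ₃, h₀ (hφ₀ _ h), h₁ (hφ₁ _ h), h₂ (hφ₂ _ h)]
  exact ⟨⟨⟨fun k => ⟨φ (graphXPoint k), hmem k⟩, fun i j h =>
    hi (Prod.ext_iff.2 (hinj _ _ (congrArg Subtype.val h)))⟩,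
    fun {i j} => (hφ _ _).trans (squareGrid_adj_graphXPoint i j)⟩⟩

/-- In the absence of induced copies of `graphX`, a square with a neighbouring square in the
horizontal direction `s` and one in the vertical direction `t` has no further neighbouring square
at the corner opposite to those. -/
theorem not_unitSquare_subset_of_turn {S : Finset (ℤ × ℤ)}
    (hX : ¬ graphX ⊴ squareGrid.induce (S : Set (ℤ × ℤ))) {x y s t : ℤ} (hs : s = 1 ∨ s = -1)
    (ht : t = 1 ∨ t = -1) (h₀ : unitSquare (x, y) ⊆ S) (h₁ : unitSquare (x + s, y) ⊆ S)
    (h₂ : unitSquare (x, y + t) ⊆ S) {d : ℤ × ℤ}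
    (hd : d = (x - s, y) ∨ d = (x, y - t) ∨ d = (x - s, y - t)) : ¬ unitSquare d ⊆ S := by
  intro h₃
  -- These equations make the symmetry with signs `s`, `t` send the centre of the square at `(0, 0)`
  -- to that of the square at `(x, y)`.
  obtain ⟨a, ha⟩ : ∃ a, 2 * a + s = 2 * x + 1 := by
    rcases hs with rfl | rfl
    exacts [⟨x, rfl⟩, ⟨x + 1, by ring⟩]
  obtain ⟨b, hb⟩ : ∃ b, 2 * b + t = 2 * y + 1 := by
    rcases ht with rfl | rfl
    exacts [⟨y, rfl⟩, ⟨y + 1, by ring⟩]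
  -- In the two cases with first coordinate `x - s`, `d` contains the image of the pendant vertex;
  -- the remaining case needs the coordinates swapped.
  rw [← or_assoc, or_right_comm] at hd
  rcases hd with hd | rfl
  · refine hX (graphX_isIndContained_of_squares (fun p => (a + s * p.1, b + t * p.2))
      h₀ h₁ h₂ h₃ ?_ ?_ ?_ ?_ ?_ ?_)
    · intro p q
      simp only [squareGrid_adj_iff]
      rcases hs with rfl | rfl <;> rcases ht with rfl | rfl <;> omega
    · intro p q h
      simp only [Prod.mk.injEq] at h
      rcases hs with rfl | rfl <;> rcases ht with rfl | rfl <;> omega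
    all_goals
      simp only [mem_unitSquare]
      rcases hs with rfl | rfl <;> rcases ht with rfl | rfl <;> rcases hd with rfl | rfl <;> omega
  · refine hX (graphX_isIndContained_of_squares (fun p => (a + s * p.2, b + t * p.1))
      h₀ h₂ h₁ h₃ ?_ ?_ ?_ ?_ ?_ ?_)
    · intro p q
      simp only [squareGrid_adj_iff]
      rcases hs with rfl | rfl <;> rcases ht with rfl | rfl <;> omega
    · intro p q h
      simp only [Prod.mk.injEq] at h
      rcases hs with rfl | rfl <;> rcases ht with rfl | rfl <;> omega
    all_goals
      simp only [mem_unitSquare]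
      rcases hs with rfl | rfl <;> rcases ht with rfl | rfl <;> omega

theorem linkGraph_adj_cases {S : Finset (ℤ × ℤ)} {x y : ℤ} {d : ℤ × ℤ}
    (h : (linkGraph S).Adj (x, y) d) :
      (d = (x + 1, y) ∧ unitSquare (x + 1, y) ⊆ S) ∨ (d = (x - 1, y) ∧ unitSquare (x - 1, y) ⊆ S) ∨
      (d = (x, y + 1) ∧ unitSquare (x, y + 1) ⊆ S) ∨ (d = (x, y - 1) ∧ unitSquare (x, y - 1) ⊆ S) ∨
      (d = (x + 1, y + 1) ∧ unitSquare (x + 1, y + 1) ⊆ S ∧ ¬ unitSquare (x, y + 1) ⊆ S ∧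
        ¬ unitSquare (x + 1, y) ⊆ S) ∨
      (d = (x - 1, y + 1) ∧ unitSquare (x - 1, y + 1) ⊆ S ∧ ¬ unitSquare (x, y + 1) ⊆ S ∧
        ¬ unitSquare (x - 1, y) ⊆ S) ∨
      (d = (x + 1, y - 1) ∧ unitSquare (x + 1, y - 1) ⊆ S ∧ ¬ unitSquare (x, y - 1) ⊆ S ∧
        ¬ unitSquare (x + 1, y) ⊆ S) ∨
      (d = (x - 1, y - 1) ∧ unitSquare (x - 1, y - 1) ⊆ S ∧ ¬ unitSquare (x, y - 1) ⊆ S ∧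
        ¬ unitSquare (x - 1, y) ⊆ S) := by
  obtain ⟨d1, d2⟩ := d
  obtain ⟨h1, -, h2, h3, h4⟩ := h
  have h5 : d1 ≠ x → d2 ≠ y → ¬ unitSquare (x, d2) ⊆ S ∧ ¬ unitSquare (d1, y) ⊆ S :=
    fun h h' => (h4.resolve_left (Ne.symm h)).resolve_left (Ne.symm h')
  clear h4
  simp only at h3
  rcases (by omega : d1 = x ∨ d1 = x + 1 ∨ d1 = x - 1) with rfl | rfl | rfl <;>
    rcases (by omega : d2 = y ∨ d2 = y + 1 ∨ d2 = y - 1) with rfl | rfl | rfl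
  · exact absurd rfl h1
  · simp [h2]
  · simp [h2]
  · simp [h2]
  · simp [h2, h5 (by omega) (by omega)]
  · simp [h2, h5 (by omega) (by omega)]
  · simp [h2]
  · simp [h2, h5 (by omega) (by omega)]
  · simp [h2, h5 (by omega) (by omega)]

-- Two diagonal squares on the same side force the square between them, which their links exclude.
-- Two edge neighbours at a right angle exclude the three squares around the opposite corner. One of
-- these facts, or the exclusion built into a diagonal link, rules out every triple of distinct
-- links.
set_option maxHeartbeats 1600000 in
theorem linkGraph_degree_le_two {S : Finset (ℤ × ℤ)}
    (hX : ¬ graphX ⊴ squareGrid.induce (S : Set (ℤ × ℤ))) (v a b c : ℤ × ℤ)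
    (ha : (linkGraph S).Adj v a) (hb : (linkGraph S).Adj v b) (hc : (linkGraph S).Adj v c) :
    a = b ∨ a = c ∨ b = c := by
  obtain ⟨x, y⟩ := v
  have h0 := ha.2.1
  have f1 : unitSquare (x + 1, y + 1) ⊆ S → unitSquare (x - 1, y + 1) ⊆ S →
      unitSquare (x, y + 1) ⊆ S := by
    simp only [unitSquare_subset_iff, sub_add_cancel] at h0 ⊢; tauto
  have f2 : unitSquare (x + 1, y - 1) ⊆ S → unitSquare (x - 1, y - 1) ⊆ S →
      unitSquare (x, y - 1) ⊆ S := by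
    simp only [unitSquare_subset_iff, sub_add_cancel] at h0 ⊢; tauto
  have f3 : unitSquare (x + 1, y + 1) ⊆ S → unitSquare (x + 1, y - 1) ⊆ S →
      unitSquare (x + 1, y) ⊆ S := by
    simp only [unitSquare_subset_iff, sub_add_cancel] at h0 ⊢; tauto
  have f4 : unitSquare (x - 1, y + 1) ⊆ S → unitSquare (x - 1, y - 1) ⊆ S →
      unitSquare (x - 1, y) ⊆ S := by
    simp only [unitSquare_subset_iff, sub_add_cancel] at h0 ⊢; tauto
  have e1 := fun h1 h2 d => not_unitSquare_subset_of_turn hX (s := 1) (t := 1) (Or.inl rfl)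
    (Or.inl rfl) h0 h1 h2 (d := d)
  have e2 := fun h1 h2 d => not_unitSquare_subset_of_turn hX (s := -1) (t := -1) (Or.inr rfl)
    (Or.inr rfl) h0 h1 h2 (d := d)
  have e3 := fun h1 h2 d => not_unitSquare_subset_of_turn hX (s := -1) (t := 1) (Or.inr rfl)
    (Or.inl rfl) h0 h1 h2 (d := d)
  have e4 := fun h1 h2 d => not_unitSquare_subset_of_turn hX (s := 1) (t := -1) (Or.inl rfl)
    (Or.inr rfl) h0 h1 h2 (d := d)
  simp only [← sub_eq_add_neg, sub_neg_eq_add, forall_eq_or_imp, forall_eq, imp_and]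
    at e1 e2 e3 e4
  obtain ⟨e11, e12, e13⟩ := e1
  obtain ⟨e21, e22, e23⟩ := e2
  obtain ⟨e31, e32, e33⟩ := e3
  obtain ⟨e41, e42, e43⟩ := e4
  have ha := linkGraph_adj_cases ha
  have hb := linkGraph_adj_cases hb
  have hc := linkGraph_adj_cases hc
  clear h0 hX
  generalize (unitSquare (x + 1, y) ⊆ S) = cE at *
  generalize (unitSquare (x - 1, y) ⊆ S) = cW at *
  generalize (unitSquare (x, y + 1) ⊆ S) = cN at *
  generalize (unitSquare (x, y - 1) ⊆ S) = cS at *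
  generalize (unitSquare (x + 1, y + 1) ⊆ S) = cNE at *
  generalize (unitSquare (x - 1, y + 1) ⊆ S) = cNW at *
  generalize (unitSquare (x + 1, y - 1) ⊆ S) = cSE at *
  generalize (unitSquare (x - 1, y - 1) ⊆ S) = cSW at *
  rcases ha with ⟨rfl, a1⟩ | ⟨rfl, a1⟩ | ⟨rfl, a1⟩ | ⟨rfl, a1⟩ | ⟨rfl, a1, a2, a3⟩ |
    ⟨rfl, a1, a2, a3⟩ | ⟨rfl, a1, a2, a3⟩ | ⟨rfl, a1, a2, a3⟩ <;>
  rcases hb with ⟨rfl, b1⟩ | ⟨rfl, b1⟩ | ⟨rfl, b1⟩ | ⟨rfl, b1⟩ | ⟨rfl, b1, b2, b3⟩ |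
    ⟨rfl, b1, b2, b3⟩ | ⟨rfl, b1, b2, b3⟩ | ⟨rfl, b1, b2, b3⟩ <;>
  first
  | exact Or.inl rfl
  | (exfalso; solve_by_elim)
  | (rcases hc with ⟨rfl, c1⟩ | ⟨rfl, c1⟩ | ⟨rfl, c1⟩ | ⟨rfl, c1⟩ | ⟨rfl, c1, c2, c3⟩ |
      ⟨rfl, c1, c2, c3⟩ | ⟨rfl, c1, c2, c3⟩ | ⟨rfl, c1, c2, c3⟩ <;>
      first
      | exact Or.inr (Or.inl rfl)
      | exact Or.inr (Or.inr rfl)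
      | (exfalso; solve_by_elim))

/-! ### From the layout of squares to intervals of points -/

theorem exists_interval_of_layout {S : Finset (ℤ × ℤ)} (hS : MadeOfSquares S)
    {r : ℤ × ℤ → ℕ} (hinj : Set.InjOn r (S.filter fun c => unitSquare c ⊆ S))
    (hlink : ∀ a b, (linkGraph S).Adj a b → r a = r b + 1 ∨ r b = r a + 1) :
    ∃ s e : ℤ × ℤ → ℕ, ∀ u ∈ S, ∀ v ∈ S, (s u ≤ e v ∧ s v ≤ e u ↔
      ∃ c, unitSquare c ⊆ S ∧ u ∈ unitSquare c ∧ v ∈ unitSquare c) := by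
  classical
  have hself : ∀ c, unitSquare c ⊆ S → c ∈ (S.filter fun c => unitSquare c ⊆ S) := fun c hc =>
    Finset.mem_filter.2 ⟨hc (mem_unitSquare.2 ⟨Or.inl rfl, Or.inl rfl⟩), hc⟩
  have hrinj : ∀ a b, unitSquare a ⊆ S → unitSquare b ⊆ S → r a = r b → a = b :=
    fun a b ha hb h => hinj (hself a ha) (hself b hb) h
  have hconv : ∀ p a b c, unitSquare a ⊆ S → unitSquare b ⊆ S → unitSquare c ⊆ S →
      p ∈ unitSquare a → p ∈ unitSquare c → r a < r b → r b < r c → p ∈ unitSquare b := by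
    intro p a b c ha hb hc hpa hpc hab hbc
    -- Squares `a` and `c` share `p` but are not consecutive, hence not linked. So they meet
    -- diagonally and some square of `S` between them is linked to both; it contains `p`, and its
    -- place forces it to be `b`.
    have hnl : ¬ (linkGraph S).Adj a c := fun h => by
      have := hlink a c h
      omega
    have hac : a ≠ c := fun h => by subst h; omega
    rw [mem_unitSquare] at hpa hpc
    have through : ∀ d, unitSquare d ⊆ S → (linkGraph S).Adj a d → (linkGraph S).Adj d c →
        p ∈ unitSquare d → p ∈ unitSquare b := by
      intro d hd h1 h2 hp
      have h3 := hlink _ _ h1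
      have h4 := hlink _ _ h2
      rwa [hrinj b d hb hd (by omega)]
    obtain ⟨a1, a2⟩ := a
    obtain ⟨c1, c2⟩ := c
    by_cases hdiag : a1 ≠ c1 ∧ a2 ≠ c2
    · have hor : unitSquare (a1, c2) ⊆ S ∨ unitSquare (c1, a2) ⊆ S := by
        by_contra! hcon
        exact hnl ⟨hac, ha, hc, by simp only at *; omega, Or.inr (Or.inr hcon)⟩
      rcases hor with h | h
      · refine through _ h ⟨?_, ha, h, ?_, Or.inl rfl⟩ ⟨?_, h, hc, ?_, Or.inr (Or.inl rfl)⟩ ?_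
        · simpa using hdiag.2
        · simp only at *; omega
        · simpa using hdiag.1
        · simp only at *; omega
        · exact mem_unitSquare.2 ⟨hpa.1, hpc.2⟩
      · refine through _ h ⟨?_, ha, h, ?_, Or.inr (Or.inl rfl)⟩ ⟨?_, h, hc, ?_, Or.inl rfl⟩ ?_
        · simpa using hdiag.1
        · simp only at *; omega
        · simpa using hdiag.2
        · simp only at *; omega
        · exact mem_unitSquare.2 ⟨hpc.1, hpa.2⟩
    · refine absurd ⟨hac, ha, hc, ?_, ?_⟩ hnl
      · simp only at *; omega
      · simp only at *; omega
  let C : ℤ × ℤ → Finset (ℤ × ℤ) := fun p => S.filter fun c => unitSquare c ⊆ S ∧ p ∈ unitSquare c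
  have hC : ∀ p c, c ∈ C p ↔ unitSquare c ⊆ S ∧ p ∈ unitSquare c := fun p c => by
    simp only [C, Finset.mem_filter, and_iff_right_iff_imp]
    exact fun h => h.1 (mem_unitSquare.2 ⟨Or.inl rfl, Or.inl rfl⟩)
  have hmin : ∀ p, ∃ c, p ∈ S → c ∈ C p ∧ ∀ d ∈ C p, r c ≤ r d := by
    intro p
    by_cases hp : p ∈ S
    · obtain ⟨c, hc⟩ := hS.1 p hp
      obtain ⟨c, hc, hm⟩ := (C p).exists_min_image r ⟨c, (hC p c).2 hc⟩
      exact ⟨c, fun _ => ⟨hc, hm⟩⟩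
    · exact ⟨0, fun h => absurd h hp⟩
  have hmax : ∀ p, ∃ c, p ∈ S → c ∈ C p ∧ ∀ d ∈ C p, r d ≤ r c := by
    intro p
    by_cases hp : p ∈ S
    · obtain ⟨c, hc⟩ := hS.1 p hp
      obtain ⟨c, hc, hm⟩ := (C p).exists_max_image r ⟨c, (hC p c).2 hc⟩
      exact ⟨c, fun _ => ⟨hc, hm⟩⟩
    · exact ⟨0, fun h => absurd h hp⟩
  choose lo hlo using hmin
  choose hi hhi using hmax
  -- The first square of `u` falls between the first and last squares of `v`, so by `hconv` it
  -- contains `v`.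
  have half : ∀ u ∈ S, ∀ v ∈ S, r (lo u) ≤ r (hi v) → r (lo v) ≤ r (lo u) →
      ∃ c, unitSquare c ⊆ S ∧ u ∈ unitSquare c ∧ v ∈ unitSquare c := by
    intro u hu v hv h1 h2
    have a1 := (hC _ _).1 (hlo u hu).1
    have a2 := (hC _ _).1 (hlo v hv).1
    have a3 := (hC _ _).1 (hhi v hv).1
    refine ⟨lo u, a1.1, a1.2, ?_⟩
    rcases h1.lt_or_eq with h1 | h1
    · rcases h2.lt_or_eq with h2 | h2
      · exact hconv v _ _ _ a2.1 a1.1 a3.1 a2.2 a3.2 h2 h1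
      · rw [← hrinj _ _ a2.1 a1.1 h2]; exact a2.2
    · rw [hrinj _ _ a1.1 a3.1 h1]; exact a3.2
  refine ⟨fun p => r (lo p), fun p => r (hi p), fun u hu v hv => ⟨?_, ?_⟩⟩
  · rintro ⟨h1, h2⟩
    rcases le_total (r (lo v)) (r (lo u)) with h | h
    · exact half u hu v hv h1 h
    · obtain ⟨c, hc, h3, h4⟩ := half v hv u hu h2 h
      exact ⟨c, hc, h4, h3⟩
  · rintro ⟨c, hc, hu', hv'⟩
    have hcu := (hC u c).2 ⟨hc, hu'⟩
    have hcv := (hC v c).2 ⟨hc, hv'⟩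
    exact ⟨((hlo u hu).2 c hcu).trans ((hhi v hv).2 c hcv),
      ((hlo v hv).2 c hcv).trans ((hhi u hu).2 c hcu)⟩

theorem IsFAvoiding.hasIntervalModel_induce {S : Finset (ℤ × ℤ)} (hS : MadeOfSquares S)
    (h : IsFAvoiding (squareGrid.induce (S : Set (ℤ × ℤ)))) :
    HasIntervalModel (squareGrid.induce (S : Set (ℤ × ℤ))) := by
  classical
  obtain ⟨r, hinj, hr⟩ := exists_layout (linkGraph_isAcyclic h.2) (linkGraph_degree_le_two h.1)
    (S.filter fun c => unitSquare c ⊆ S)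
  have hself : ∀ c, unitSquare c ⊆ S → c ∈ (S.filter fun c => unitSquare c ⊆ S) := fun c hc =>
    Finset.mem_filter.2 ⟨hc (mem_unitSquare.2 ⟨Or.inl rfl, Or.inl rfl⟩), hc⟩
  obtain ⟨s, e, hse⟩ := exists_interval_of_layout hS hinj
    fun a b hab => hr a (hself a hab.2.1) b (hself b hab.2.2.1) hab
  refine hasIntervalModel_of_bipartite_intervals (fun p => (p.1.1 + p.1.2) % 2 = 0)
    (fun p => s p.1) (fun p => e p.1) ?_
  rintro ⟨u, hu⟩ ⟨v, hv⟩
  change squareGrid.Adj u v ↔ _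
  simp only
  rw [hse u hu v hv]
  constructor
  · intro huv
    obtain ⟨c, hc, h1, h2⟩ := hS.2 u hu v hv huv
    have := even_add_of_squareGrid_adj huv
    exact ⟨by omega, c, hc, h1, h2⟩
  · rintro ⟨hpar, c, -, h1, h2⟩
    rw [mem_unitSquare] at h1 h2
    rw [squareGrid_adj_iff]
    omega

theorem theorem2p12 {V : Type*} (G : SimpleGraph V) (hG : IsSquareGridGraph G) :
    Is12Representable G ↔ IsFAvoiding G := by
  obtain ⟨S, hS, ⟨φ⟩⟩ := hG
  have : Finite V := Finite.of_equiv _ φ.toEquiv.symm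
  constructor
  · intro h
    have hM := h.hasIntervalModel
    exact ⟨fun ⟨f⟩ => graphX_not_hasIntervalModel (hM.comap f),
      fun n hn ⟨f⟩ => cycleGraph_not_hasIntervalModel (by omega) (hM.comap f)⟩
  · intro h
    have hF : IsFAvoiding (squareGrid.induce (S : Set (ℤ × ℤ))) :=
      ⟨fun hX => h.1 (hX.trans ⟨φ.symm.toEmbedding⟩),
        fun n hn hc => h.2 n hn (hc.trans ⟨φ.symm.toEmbedding⟩)⟩
    exact ((hF.hasIntervalModel_induce hS).comap φ.toEmbedding).is12Representable
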